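/- Let $\pi: Y\to X$ be a smooth fibre bundle (a smooth surjective submersion suffices) with finite-dimensional fibres, whose base has dimension $n+1\ge 2$ and carries a volume form $\eta$. Let $J^1\pi$ be its first jet bundle, with projections $\pi_{1,0}:J^1\pi\to Y$ and $\pi_1=\pi\circ\pi_{1,0}$ and adapted coordinates $(x^\mu,y^a,y^a_\mu)$ such that $\eta=d^{n+1}x$. Put $d^nx_\mu=i_{\partial/\partial x^\mu}\eta$ and $\theta^a=dy^a-y^a_\nu dx^\nu$. Let $L\in C^\infty(J^1\pi)$ be a regular Lagrangian, i.e. $\det\big(\partial^2L/\partial y^a_\mu\partial y^b_\nu\big)\neq0$ everywhere, and let $\Omega_L=-d\Theta_L$ be its Poincaré–Cartan form, where $\Theta_L=\frac{\partial L}{\partial y^a_\mu}\,\theta^a\wedge d^nx_\mu+L\,\eta$. Let $\mathcal C\subset J^1\pi$ be a submanifold of codimension $k$ that projects onto $Y$ and is locally given by equations $\varphi_\alpha=0$ ($1\le\alpha\le k$) with $(\partial\varphi_\alpha/\partial y^a_\mu)$ of rank $k$ along $\mathcal C$. Let $\mathcal F$ be a submodule, over the smooth functions, of the module of smooth $(n+1)$-forms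 on an open neighbourhood of $\mathcal C$ that vanish when contracted with any two $\pi_1$-vertical vectors and pull back to $0$ under the first jet prolongation $j^1\phi$ of every local section $\phi$ of $\pi$. Assume that $\mathcal C$ is covered by open sets $U$ on each of which $\mathcal F$ is generated by $k$ pointwise linearly independent smooth forms $$\Phi_\alpha=(C_\alpha)^\mu_a\,\theta^a\wedge d^nx_\mu,\qquad 1\le\alpha\le k$$ ("local generators on $U$"). Let $F_\gamma=\{\Phi(\gamma):\Phi\in\mathcal F\}$, $\gamma\in\mathcal C$, be the fibres of the bundle $F$ of constraint forms. 1. For all local generators $\Phi_1,\dots,\Phi_k$ on an open set $U$ and each $\alpha$ there is a unique smooth vector field $\zeta_\alpha$ on $U$ with $i_{\zeta_\alpha}\Omega_L=-\Phi_\alpha$. It is $\pi_{1,0}$-vertical, $\zeta_\alpha=(\zeta_\alpha)^a_\mu\,\partial/\partial y^a_\mu$, and its coefficients are the unique solution of $(\zeta_\alpha)^a_\mu\,\frac{\partial^2L}{\partial y^a_\mu\partial y^b_\nu}=(C_\alpha)^\nu_b$. At every point of $U$ the vectors $\zeta_1,\dots,\zeta_k$ span a $k$-dimensional space $D_U$.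 2. If two families of local generators are given on open sets $U$ and $V$, then $D_U=D_V$ at every point of $U\cap V$. 3. Consequently there is a well-defined distribution $D$ of rank $k$ along $\mathcal C$ with $D(\gamma)=D_U(\gamma)$ for every choice of local generators on an open set $U\ni\gamma$; it is the only distribution obtained in this way from any choice of local generators covering $\mathcal C$. It depends only on the bundle $F$: for $\gamma\in\mathcal C$, $D(\gamma)$ is the set of $\pi_{1,0}$-vertical vectors $v\in T_\gamma J^1\pi$ with $i_v\Omega_L(\gamma)\in F_\gamma$. -/

import Mathlib

set_option maxSynthPendingDepth 3

open Set Manifold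
open scoped ContDiff Topology

noncomputable section

namespace FieldTheory

section Manifolds

variable {W : Type*} [NormedAddCommGroup W] [NormedSpace ℝ W]

/-- Differential `k`-forms (not necessarily smooth) on a manifold `M` modelled on `W`; recall that
Mathlib's `TangentSpace 𝓘(ℝ, W) j` is the vector space `W`. -/
abbrev Form (W : Type*) [NormedAddCommGroup W] [NormedSpace ℝ W] (M : Type*) (k : ℕ) : Type _ :=
  M → W [⋀^Fin k]→L[ℝ] ℝ

variable {M : Type*} [TopologicalSpace M] [ChartedSpace W M] {k : ℕ}

/-- The differential `T_y M → W` of a chart. -/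
def dChart (e : OpenPartialHomeomorph M W) (y : M) : W →L[ℝ] W :=
  mfderiv 𝓘(ℝ, W) 𝓘(ℝ, W) e y

/-- The differential `W → T_y M`, `y = e⁻¹ z`, of the inverse of a chart. -/
def dChartSymm (e : OpenPartialHomeomorph M W) (z : W) : W →L[ℝ] W :=
  mfderiv 𝓘(ℝ, W) 𝓘(ℝ, W) e.symm z

/-- The coordinate expression of a form in the preferred chart at `j₀`: its pullback by the inverse
of that chart. -/
def Form.inChart (Φ : Form W M k) (j₀ : M) : W → W [⋀^Fin k]→L[ℝ] ℝ := fun z =>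
  (Φ ((chartAt W j₀).symm z)).compContinuousLinearMap (dChartSymm (chartAt W j₀) z)

/-- The form `Φ` is smooth on the open set `U`: its expression in every chart is smooth. -/
def Form.SmoothOn (Φ : Form W M k) (U : Set M) : Prop :=
  ∀ j₀ : M, ContDiffOn ℝ ∞ (Φ.inChart j₀) ((chartAt W j₀).target ∩ (chartAt W j₀).symm ⁻¹' U)

/-- The exterior derivative of a form on a manifold, computed at `j` in the chart at `j`. -/
def Form.d (Φ : Form W M k) : Form W M (k + 1) := fun j =>
  (extDeriv (Φ.inChart j) (chartAt W j j)).compContinuousLinearMap (dChart (chartAt W j) j)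

/-- The vector field `ζ` is smooth on the open set `U`. -/
def SmoothFieldOn [IsManifold 𝓘(ℝ, W) ∞ M] (ζ : M → W) (U : Set M) : Prop :=
  ContMDiffOn 𝓘(ℝ, W) 𝓘(ℝ, W).tangent ∞ (fun j => (⟨j, ζ j⟩ : TangentBundle 𝓘(ℝ, W) M)) U

variable {e e' : OpenPartialHomeomorph M W}

lemma mdifferentiableAt_chart (he : e ∈ IsManifold.maximalAtlas 𝓘(ℝ, W) ∞ M) {y : M}
    (hy : y ∈ e.source) : MDifferentiableAt 𝓘(ℝ, W) 𝓘(ℝ, W) e y :=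
  (contMDiffAt_of_mem_maximalAtlas he hy).mdifferentiableAt (by simp)

lemma mdifferentiableAt_chart_symm (he : e ∈ IsManifold.maximalAtlas 𝓘(ℝ, W) ∞ M) {z : W}
    (hz : z ∈ e.target) : MDifferentiableAt 𝓘(ℝ, W) 𝓘(ℝ, W) e.symm z :=
  (contMDiffAt_symm_of_mem_maximalAtlas he hz).mdifferentiableAt (by simp)

lemma dChart_comp_dChartSymm_eq (he : e ∈ IsManifold.maximalAtlas 𝓘(ℝ, W) ∞ M)
    (he' : e' ∈ IsManifold.maximalAtlas 𝓘(ℝ, W) ∞ M) {z : W} (hz : z ∈ e.target)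
    (hz' : e.symm z ∈ e'.source) :
    (dChart e' (e.symm z)).comp (dChartSymm e z) = fderiv ℝ (e' ∘ e.symm) z := by
  rw [← mfderiv_eq_fderiv]
  exact (mfderiv_comp z (mdifferentiableAt_chart he' hz')
    (mdifferentiableAt_chart_symm he hz)).symm

lemma dChart_comp_dChartSymm (he : e ∈ IsManifold.maximalAtlas 𝓘(ℝ, W) ∞ M) {y : M}
    (hy : y ∈ e.source) :
    (dChart e y).comp (dChartSymm e (e y)) = ContinuousLinearMap.id ℝ W := by
  have h := dChart_comp_dChartSymm_eq he he (e.map_source hy) (by simp [hy])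
  rw [e.left_inv hy] at h
  rw [h]
  have : (e ∘ e.symm) =ᶠ[𝓝 (e y)] id := by
    filter_upwards [e.open_target.mem_nhds (e.map_source hy)] with z hz
    simp [e.right_inv hz]
  rw [this.fderiv_eq, fderiv_id]

lemma dChartSymm_comp_dChart (he : e ∈ IsManifold.maximalAtlas 𝓘(ℝ, W) ∞ M) {y : M}
    (hy : y ∈ e.source) :
    (dChartSymm e (e y)).comp (dChart e y) = ContinuousLinearMap.id ℝ W := by
  have h := mfderiv_comp (I := 𝓘(ℝ, W)) (I' := 𝓘(ℝ, W)) (I'' := 𝓘(ℝ, W)) y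
    (mdifferentiableAt_chart_symm he (e.map_source hy)) (mdifferentiableAt_chart he hy)
  have : (e.symm ∘ e) =ᶠ[𝓝 y] id := by
    filter_upwards [e.open_source.mem_nhds hy] with z hz
    simp [e.left_inv hz]
  rw [this.mfderiv_eq, mfderiv_id] at h
  exact h.symm

end Manifolds

section Jets

variable {E F : Type*} [NormedAddCommGroup E] [NormedSpace ℝ E]
  [NormedAddCommGroup F] [NormedSpace ℝ F]
  {X Y : Type*} [TopologicalSpace X] [ChartedSpace E X] [TopologicalSpace Y] [ChartedSpace (E × F) Y]

variable (E F) in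
/-- The differential `T_y Y → T_{π y} X`. -/
def dProj (π : Y → X) (y : Y) : (E × F) →L[ℝ] E :=
  mfderiv 𝓘(ℝ, E × F) 𝓘(ℝ, E) π y

variable (E F) in
/-- `π : Y → X` is a smooth surjective submersion, with fibres modelled on `F`. -/
class IsFibredManifold (π : Y → X) : Prop where
  surjective : Function.Surjective π
  isSubmersion : IsSubmersionOfComplement F 𝓘(ℝ, E × F) 𝓘(ℝ, E) ∞ π

variable (E F) in
/-- The first jet bundle of `π`. The 1-jet at `x` of a local section `φ` is recorded as its value
`φ x` together with its differential `T_x X → T_{φ x} Y`, a right inverse of the differential of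
`π`. -/
@[ext]
structure J1 (π : Y → X) where
  base : Y
  jet : E →L[ℝ] (E × F)
  isSection : (dProj E F π base).comp jet = ContinuousLinearMap.id ℝ E

/-- A chart `e` of `Y` and a chart `c` of `X` in which `π` is `(x, y) ↦ x`. -/
structure IsAdapted (π : Y → X) (e : OpenPartialHomeomorph Y (E × F))
    (c : OpenPartialHomeomorph X E) : Prop where
  mem_left : e ∈ IsManifold.maximalAtlas 𝓘(ℝ, E × F) ∞ Y
  mem_right : c ∈ IsManifold.maximalAtlas 𝓘(ℝ, E) ∞ X
  mapsTo : MapsTo π e.source c.source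
  fst_eq : ∀ y ∈ e.source, (e y).1 = c (π y)

variable {π : Y → X}
  {e e' : OpenPartialHomeomorph Y (E × F)} {c c' : OpenPartialHomeomorph X E}

lemma exists_isAdapted [IsManifold 𝓘(ℝ, E × F) ∞ Y] (π : Y → X) [h : IsFibredManifold E F π] (y : Y) :
    ∃ p : OpenPartialHomeomorph Y (E × F) × OpenPartialHomeomorph X E,
      y ∈ p.1.source ∧ IsAdapted π p.1 p.2 := by
  have hy := h.isSubmersion y
  have hd := hy.domChart_mem_maximalAtlas
  have hw := hy.writtenInCharts
  refine ⟨(hy.domChart.transHomeomorph hy.equiv.toHomeomorph, hy.codChart),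
    by simpa using hy.mem_domChart_source, ?_, hy.codChart_mem_maximalAtlas, ?_, ?_⟩
  · rw [IsManifold.mem_maximalAtlas_iff_contMDiffOn] at hd ⊢
    constructor
    · exact hy.equiv.contDiff.contMDiff.comp_contMDiffOn hd.1
    · exact hd.2.comp hy.equiv.symm.contDiff.contMDiff.contMDiffOn (by intro z hz; simpa using hz)
  · exact hy.mapsto_domChart_source_codChart_source
  · intro z hz
    have hz' : z ∈ hy.domChart.source := by simpa using hz
    have := hw (x := hy.domChart z) (by simpa using hy.domChart.map_source hz')
    simpa [hz'] using this.symm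

lemma IsAdapted.proj_symm (h : IsAdapted π e c) {z : E × F} (hz : z ∈ e.target) :
    c (π (e.symm z)) = z.1 := by
  rw [← h.fst_eq _ (e.map_target hz), e.right_inv hz]

lemma IsAdapted.proj_eq (h : IsAdapted π e c) {z : E × F} (hz : z ∈ e.target) :
    π (e.symm z) = c.symm z.1 := by
  rw [← h.proj_symm hz, c.left_inv (h.mapsTo (e.map_target hz))]

lemma IsAdapted.fst_mem (h : IsAdapted π e c) {z : E × F} (hz : z ∈ e.target) :
    z.1 ∈ c.target := by
  rw [← h.proj_symm hz]
  exact c.map_source (h.mapsTo (e.map_target hz))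

lemma IsAdapted.dProj_eq (h : IsAdapted π e c) {y : Y} (hy : y ∈ e.source) :
    dProj E F π y = (dChartSymm c (c (π y))).comp
      ((ContinuousLinearMap.fst ℝ E F).comp (dChart e y)) := by
  have hev : π =ᶠ[𝓝 y] c.symm ∘ (Prod.fst ∘ e) := by
    filter_upwards [e.open_source.mem_nhds hy] with w hw
    simp [h.fst_eq w hw, h.mapsTo hw]
  have h1 := mdifferentiableAt_chart h.mem_left hy
  have hfst : MDifferentiableAt 𝓘(ℝ, E × F) 𝓘(ℝ, E) (Prod.fst : E × F → E) (e y) :=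
    differentiableAt_fst.mdifferentiableAt
  have h2 : MDifferentiableAt 𝓘(ℝ, E) 𝓘(ℝ, E) c.symm ((Prod.fst ∘ e) y) := by
    apply mdifferentiableAt_chart_symm h.mem_right
    simpa [h.fst_eq y hy] using c.map_source (h.mapsTo hy)
  have h3 : mfderiv 𝓘(ℝ, E × F) 𝓘(ℝ, E) (Prod.fst : E × F → E) (e y)
      = ContinuousLinearMap.fst ℝ E F := by
    rw [mfderiv_eq_fderiv, fderiv_fst]
  have h4 := mfderiv_comp y h2 (hfst.comp y h1)
  rw [mfderiv_comp y hfst h1, h3] at h4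
  unfold dProj
  rw [hev.mfderiv_eq]
  refine h4.trans ?_
  have h5 : (Prod.fst ∘ e) y = c (π y) := h.fst_eq y hy
  rw [h5]
  rfl

/-- A jet whose expression in adapted charts is `(z, B)`. -/
def IsAdapted.mkJet (h : IsAdapted π e c) (z : E × F) (hz : z ∈ e.target) (B : E →L[ℝ] F) :
    J1 E F π where
  base := e.symm z
  jet := (dChartSymm e z).comp
    (((ContinuousLinearMap.id ℝ E).prod B).comp (dChart c (π (e.symm z))))
  isSection := by
    have hy := e.map_target hz
    have h1 := dChart_comp_dChartSymm h.mem_left hy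
    rw [e.right_inv hz] at h1
    have h2 := dChartSymm_comp_dChart h.mem_right (h.mapsTo hy)
    rw [h.dProj_eq hy]
    ext u
    have h1' := fun v => DFunLike.congr_fun h1 v
    have h2' := DFunLike.congr_fun h2 u
    simp only [ContinuousLinearMap.comp_apply, ContinuousLinearMap.id_apply] at h1' h2' ⊢
    rw [h1']
    simpa using h2'

open Classical in
/-- The chart `(x, y, y_x)` of the jet bundle induced by adapted charts of `X` and `Y`. (The jet
`j₀` is a junk value: the inverse of a chart has to be defined everywhere.) -/
def IsAdapted.jetChart (h : IsAdapted π e c) (j₀ : J1 E F π) :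
    PartialEquiv (J1 E F π) ((E × F) × (E →L[ℝ] F)) where
  toFun j := (e j.base, (ContinuousLinearMap.snd ℝ E F).comp
    ((dChart e j.base).comp (j.jet.comp (dChartSymm c (c (π j.base))))))
  invFun p := if hp : p.1 ∈ e.target then h.mkJet p.1 hp p.2 else j₀
  source := {j | j.base ∈ e.source}
  target := {p | p.1 ∈ e.target}
  map_source' j hj := e.map_source hj
  map_target' p hp := by
    have hp' : p.1 ∈ e.target := hp
    simp [hp', IsAdapted.mkJet]
  left_inv' j hj := by
    have hj' : j.base ∈ e.source := hj
    simp only [e.map_source hj', dif_pos]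
    apply J1.ext
    · exact e.left_inv hj'
    · have h1 := fun v => DFunLike.congr_fun (dChartSymm_comp_dChart h.mem_left hj') v
      have h2 := fun v => DFunLike.congr_fun
        (dChartSymm_comp_dChart h.mem_right (h.mapsTo hj')) v
      have h3 := fun v => DFunLike.congr_fun
        (dChart_comp_dChartSymm h.mem_right (h.mapsTo hj')) v
      have h4 := fun v => DFunLike.congr_fun j.isSection v
      simp only [ContinuousLinearMap.comp_apply, ContinuousLinearMap.id_apply] at h1 h2 h3 h4
      ext1 u
      have h5 : (dChart e j.base (j.jet u)).1 = dChart c (π j.base) u := by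
        have h6 := DFunLike.congr_fun (h.dProj_eq hj') (j.jet u)
        rw [h4] at h6
        conv_rhs => rw [h6]
        simp [h3]
      simp only [IsAdapted.mkJet, ContinuousLinearMap.comp_apply, e.left_inv hj',
        ContinuousLinearMap.prod_apply, ContinuousLinearMap.id_apply, h2]
      rw [← h5]
      exact h1 (j.jet u)
  right_inv' p hp := by
    have hp' : p.1 ∈ e.target := hp
    have hy := e.map_target hp'
    have h1 := fun v => DFunLike.congr_fun (dChart_comp_dChartSymm h.mem_left hy) v
    have h2 := fun v => DFunLike.congr_fun
      (dChart_comp_dChartSymm h.mem_right (h.mapsTo hy)) v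
    rw [e.right_inv hp'] at h1
    simp only [ContinuousLinearMap.comp_apply, ContinuousLinearMap.id_apply] at h1 h2
    simp only [hp', dif_pos]
    refine Prod.ext (e.right_inv hp') ?_
    ext u
    simp [IsAdapted.mkJet, h1, h2]

/-- The change of jet charts is smooth. -/
lemma IsAdapted.contDiffOn_change (h : IsAdapted π e c) (h' : IsAdapted π e' c')
    (j₀ j₀' : J1 E F π) :
    IsOpen ((h.jetChart j₀).symm.trans (h'.jetChart j₀')).source ∧
    ContDiffOn ℝ ∞ ((h.jetChart j₀).symm.trans (h'.jetChart j₀'))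
      ((h.jetChart j₀).symm.trans (h'.jetChart j₀')).source := by
  have hsrc : ((h.jetChart j₀).symm.trans (h'.jetChart j₀')).source =
      Prod.fst ⁻¹' (e.symm.trans e').source := by
    ext p
    simp only [PartialEquiv.trans_source, mem_inter_iff, mem_preimage,
      OpenPartialHomeomorph.trans_source, OpenPartialHomeomorph.symm_source]
    refine and_congr_right fun hp => ?_
    have hp' : p.1 ∈ e.target := hp
    simp [IsAdapted.jetChart, hp', IsAdapted.mkJet]
  have hopen : IsOpen (e.symm.trans e').source := (e.symm.trans e').open_source
  have hτ : ContDiffOn ℝ ∞ (e' ∘ e.symm) (e.symm.trans e').source := by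
    rw [← contMDiffOn_iff_contDiffOn]
    exact (contMDiffOn_of_mem_maximalAtlas h'.mem_left).comp
      ((contMDiffOn_symm_of_mem_maximalAtlas h.mem_left).mono (fun z hz => hz.1))
      (fun z hz => hz.2)
  have hσ : ContDiffOn ℝ ∞ (c ∘ c'.symm) (c'.symm.trans c).source := by
    rw [← contMDiffOn_iff_contDiffOn]
    exact (contMDiffOn_of_mem_maximalAtlas h.mem_right).comp
      ((contMDiffOn_symm_of_mem_maximalAtlas h'.mem_right).mono (fun z hz => hz.1))
      (fun z hz => hz.2)
  have hτ' : ContDiffOn ℝ ∞ (fderiv ℝ (e' ∘ e.symm)) (e.symm.trans e').source :=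
    hτ.fderiv_of_isOpen hopen (by simp)
  have hσ' : ContDiffOn ℝ ∞ (fderiv ℝ (c ∘ c'.symm)) (c'.symm.trans c).source :=
    hσ.fderiv_of_isOpen (c'.symm.trans c).open_source (by simp)
  have hmem : ∀ z ∈ (e.symm.trans e').source, ((e' ∘ e.symm) z).1 ∈ (c'.symm.trans c).source := by
    intro z hz
    have hz1 : z ∈ e.target := hz.1
    have hz2 : e.symm z ∈ e'.source := hz.2
    have hfst : (e' (e.symm z)).1 = c' (π (e.symm z)) := h'.fst_eq _ hz2
    have h1 : c' (π (e.symm z)) ∈ c'.target := c'.map_source (h'.mapsTo hz2)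
    have h2 : π (e.symm z) ∈ c.source := h.mapsTo (e.map_target hz1)
    simp [hfst, h1, c'.left_inv (h'.mapsTo hz2), h2]
  rw [hsrc]
  refine ⟨hopen.preimage continuous_fst, ?_⟩
  have hfs : ContDiffOn ℝ ∞ (Prod.fst : (E × F) × (E →L[ℝ] F) → E × F)
      (Prod.fst ⁻¹' (e.symm.trans e').source) := contDiff_fst.contDiffOn
  have key : ContDiffOn ℝ ∞ (fun p : (E × F) × (E →L[ℝ] F) =>
      ((e' ∘ e.symm) p.1, (ContinuousLinearMap.snd ℝ E F).comp
        ((fderiv ℝ (e' ∘ e.symm) p.1).comp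
          (((ContinuousLinearMap.inl ℝ E F).comp (ContinuousLinearMap.id ℝ E) +
            (ContinuousLinearMap.inr ℝ E F).comp p.2).comp
            (fderiv ℝ (c ∘ c'.symm) ((e' ∘ e.symm) p.1).1)))))
      (Prod.fst ⁻¹' (e.symm.trans e').source) := by
    have hτfs := hτ.comp hfs (fun p hp => hp)
    refine hτfs.prodMk ?_
    refine contDiffOn_const.clm_comp ((hτ'.comp hfs (fun p hp => hp)).clm_comp
      (ContDiffOn.clm_comp ?_ ?_))
    · exact contDiffOn_const.add (contDiffOn_const.clm_comp contDiff_snd.contDiffOn)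
    · exact hσ'.comp (contDiff_fst.comp_contDiffOn hτfs) (fun p hp => hmem _ hp)
  refine key.congr ?_
  rintro ⟨z, B⟩ hz
  have hz1 : z ∈ e.target := hz.1
  have hz2 : e.symm z ∈ e'.source := hz.2
  have hfst : (e' (e.symm z)).1 = c' (π (e.symm z)) := h'.fst_eq _ hz2
  have h1 := dChart_comp_dChartSymm_eq h.mem_left h'.mem_left hz1 hz2
  have h2 := dChart_comp_dChartSymm_eq h'.mem_right h.mem_right
    (c'.map_source (h'.mapsTo hz2))
    (by simpa [h'.mapsTo hz2] using h.mapsTo (e.map_target hz1))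
  rw [c'.left_inv (h'.mapsTo hz2)] at h2
  simp only [Function.comp_apply, hfst]
  rw [← h1, ← h2]
  simp only [PartialEquiv.coe_trans, Function.comp_apply]
  refine Prod.ext ?_ ?_
  · simp [IsAdapted.jetChart, hz1, IsAdapted.mkJet]
  · ext u
    simp only [IsAdapted.jetChart, hz1, IsAdapted.mkJet, PartialEquiv.coe_symm_mk, dif_pos,
      ContinuousLinearMap.comp_apply, _root_.add_apply]
    congr 3
    simp

variable (E F) in
/-- The smooth atlas of the jet bundle, consisting of the charts induced by adapted charts. -/
def jetAtlas [IsManifold 𝓘(ℝ, E × F) ∞ Y] (π : Y → X) [IsFibredManifold E F π] :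
    ChartedSpaceCore ((E × F) × (E →L[ℝ] F)) (J1 E F π) where
  atlas := {f | ∃ (e : OpenPartialHomeomorph Y (E × F)) (c : OpenPartialHomeomorph X E)
    (h : IsAdapted π e c) (j₀ : J1 E F π), f = h.jetChart j₀}
  chartAt j := (exists_isAdapted π j.base).choose_spec.2.jetChart j
  mem_chart_source j := (exists_isAdapted π j.base).choose_spec.1
  chart_mem_atlas j := ⟨_, _, (exists_isAdapted π j.base).choose_spec.2, j, rfl⟩
  open_source := by
    rintro _ _ ⟨e, c, h, j₀, rfl⟩ ⟨e', c', h', j₀', rfl⟩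
    exact (h.contDiffOn_change h' j₀ j₀').1
  continuousOn_toFun := by
    rintro _ _ ⟨e, c, h, j₀, rfl⟩ ⟨e', c', h', j₀', rfl⟩
    exact (h.contDiffOn_change h' j₀ j₀').2.continuousOn

instance [IsManifold 𝓘(ℝ, E × F) ∞ Y] (π : Y → X) [IsFibredManifold E F π] : TopologicalSpace (J1 E F π) :=
  (jetAtlas E F π).toTopologicalSpace

instance [IsManifold 𝓘(ℝ, E × F) ∞ Y] (π : Y → X) [IsFibredManifold E F π] :
    ChartedSpace ((E × F) × (E →L[ℝ] F)) (J1 E F π) :=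
  (jetAtlas E F π).toChartedSpace

instance [IsManifold 𝓘(ℝ, E × F) ∞ Y] (π : Y → X) [IsFibredManifold E F π] :
    IsManifold 𝓘(ℝ, (E × F) × (E →L[ℝ] F)) ∞ (J1 E F π) := by
  apply isManifold_of_contDiffOn
  intro f f' hf hf'
  obtain ⟨_, ⟨_, rfl⟩, _, ⟨⟨e, c, h, j₀, rfl⟩, rfl⟩, rfl⟩ := hf
  obtain ⟨_, ⟨_, rfl⟩, _, ⟨⟨e', c', h', j₀', rfl⟩, rfl⟩, rfl⟩ := hf'
  have := (h.contDiffOn_change h' j₀ j₀').2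
  refine (this.mono ?_)
  rintro z ⟨hz, -⟩
  exact hz

variable (E F) in
/-- The model space of the jet bundle. -/
abbrev J1Model : Type _ := (E × F) × (E →L[ℝ] F)

variable [IsManifold 𝓘(ℝ, E × F) ∞ Y] [IsFibredManifold E F π]

namespace J1

/-- The differential of `π₁,₀ : J¹π → Y`. -/
def dBase (j : J1 E F π) : J1Model E F →L[ℝ] (E × F) :=
  mfderiv 𝓘(ℝ, J1Model E F) 𝓘(ℝ, E × F) (J1.base (π := π)) j

/-- The differential of `π₁ = π ∘ π₁,₀ : J¹π → X`. -/
def dBaseProj (j : J1 E F π) : J1Model E F →L[ℝ] E :=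
  (dProj E F π j.base).comp j.dBase

/-- The space of `π`-vertical tangent vectors of `Y` at the base point of a jet. -/
def Vert (j : J1 E F π) : Submodule ℝ (E × F) :=
  LinearMap.ker (dProj E F π j.base : (E × F) →ₗ[ℝ] E)

/-- The contact form `θ = θᵃ ⊗ ∂/∂yᵃ`, `θᵃ = dyᵃ - yᵃ_ν dx^ν`, with values in vertical vectors. -/
def contact (j : J1 E F π) : J1Model E F →L[ℝ] j.Vert :=
  (j.dBase - j.jet.comp j.dBaseProj).codRestrict j.Vert (by
    intro v
    have h := DFunLike.congr_fun j.isSection (j.dBaseProj v)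
    simp only [ContinuousLinearMap.comp_apply, ContinuousLinearMap.id_apply] at h
    rw [dBaseProj, ContinuousLinearMap.comp_apply] at h
    simp [Vert, dBaseProj, h])

/-- The affine structure of the fibre of `J¹π` over `Y`, which is modelled on the linear maps
`T_x X → V_y π`: the translate of `j` by `B`. -/
def translate (j : J1 E F π) (B : E →L[ℝ] j.Vert) : J1 E F π where
  base := j.base
  jet := j.jet + j.Vert.subtypeL.comp B
  isSection := by
    ext u
    have h := DFunLike.congr_fun j.isSection u
    have hB : dProj E F π j.base (B u : E × F) = 0 := (B u).2
    simp only [ContinuousLinearMap.comp_apply, ContinuousLinearMap.id_apply] at h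
    simp [h, hB]

/-- The vertical lift `V_y π ⊗ T*_x X → T_j J¹π`, `Bᵃ_μ ↦ Bᵃ_μ ∂/∂yᵃ_μ`. -/
def vlift (j : J1 E F π) : (E →L[ℝ] j.Vert) →L[ℝ] J1Model E F :=
  mfderiv 𝓘(ℝ, E →L[ℝ] j.Vert) 𝓘(ℝ, J1Model E F) j.translate 0

end J1

/-- A volume form on `X`. -/
structure IsVolumeForm {n : ℕ} (η : Form E X (n + 1)) : Prop where
  smooth : Form.SmoothOn η univ
  ne_zero : ∀ x, η x ≠ 0

variable {n k : ℕ} [FiniteDimensional ℝ E]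

/-- The `(n+1)`-form `C^μ_a θᵃ ∧ dⁿx_μ` at the jet `j`, where `dⁿx_μ = i_{∂/∂x^μ} η`. The
coefficients `C^μ_a = c (dx^μ ⊗ ∂/∂yᵃ)` are given by the linear functional `c` on
`V_y π ⊗ T*_x X`; the sum over a basis of `T_x X` does not depend on the basis. -/
def contactForm (η : Form E X (n + 1)) (j : J1 E F π) (c : (E →L[ℝ] j.Vert) →L[ℝ] ℝ) :
    J1Model E F [⋀^Fin (n + 1)]→L[ℝ] ℝ :=
  .alternatizeUncurryFin (∑ μ,
    (c.comp ((ContinuousLinearMap.smulRightL ℝ E j.Vert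
      (LinearMap.toContinuousLinearMap ((Module.finBasis ℝ E).coord μ))).comp j.contact)).smulRight
    (((η (π j.base)).curryLeft (Module.finBasis ℝ E μ)).compContinuousLinearMap j.dBaseProj))

/-- The differential `dL` at the jet `j`. -/
def dFun (L : J1 E F π → ℝ) (j : J1 E F π) : J1Model E F →L[ℝ] ℝ :=
  mfderiv 𝓘(ℝ, J1Model E F) 𝓘(ℝ, ℝ) L j

/-- `S_η^* dL + L η`, where `S_η = θᵃ ∧ dⁿx_μ ⊗ ∂/∂yᵃ_μ` is the vertical endomorphism. -/
def thetaForm (η : Form E X (n + 1)) (L : J1 E F π → ℝ) : Form (J1Model E F) (J1 E F π) (n + 1) :=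
  fun j => contactForm η j ((dFun L j).comp j.vlift) +
    L j • (η (π j.base)).compContinuousLinearMap j.dBaseProj

/-- The Poincaré-Cartan form `Ω_L = -dΘ_L`. -/
def omegaForm (η : Form E X (n + 1)) (L : J1 E F π → ℝ) : Form (J1Model E F) (J1 E F π) (n + 2) :=
  fun j => -(thetaForm η L).d j

/-- The Hessian `∂²L / ∂yᵃ_μ ∂yᵇ_ν` along the fibres of `J¹π → Y`, as a bilinear form. -/
def hessian (L : J1 E F π → ℝ) (j : J1 E F π) :
    (E →L[ℝ] j.Vert) →L[ℝ] (E →L[ℝ] j.Vert) →L[ℝ] ℝ :=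
  fderiv ℝ (fderiv ℝ (fun B => L (j.translate B))) 0

/-- The Hessian of `L` is non-degenerate at every jet. -/
def IsRegularLagrangian (L : J1 E F π → ℝ) : Prop :=
  ∀ (j : J1 E F π) (B : E →L[ℝ] j.Vert), (∀ B', hessian L j B B' = 0) → B = 0

/-- The function `f` is smooth on the open set `U` of jets. -/
def SmoothFunOn (f : J1 E F π → ℝ) (U : Set (J1 E F π)) : Prop :=
  ContMDiffOn 𝓘(ℝ, J1Model E F) 𝓘(ℝ, ℝ) ∞ f U

/-- A submanifold `C` of `J¹π` of codimension `k` which projects onto `Y`, submersively: `C` is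
locally given by `k` equations `φ_α = 0` with `(∂φ_α / ∂yᵃ_μ)` of maximal rank `k` along `C`. -/
structure IsConstraintSubmanifold (C : Set (J1 E F π)) (k : ℕ) : Prop where
  surjOn : SurjOn J1.base C univ
  equations : ∀ γ ∈ C, ∃ (U : Set (J1 E F π)) (φ : Fin k → J1 E F π → ℝ), IsOpen U ∧ γ ∈ U ∧
    (∀ α, SmoothFunOn (φ α) U) ∧ C ∩ U = {j ∈ U | ∀ α, φ α j = 0} ∧
    ∀ j ∈ C ∩ U, LinearIndependent ℝ fun α => (dFun (φ α) j).comp j.vlift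

/-- `σ` is, on the open set `V ⊆ X`, the first jet prolongation of a smooth local section `φ`. -/
structure IsProlongation (φ : X → Y) (σ : X → J1 E F π) (V : Set X) : Prop where
  isOpen : IsOpen V
  smooth : ContMDiffOn 𝓘(ℝ, E) 𝓘(ℝ, E × F) ∞ φ V
  section_eq : ∀ x ∈ V, π (φ x) = x
  base_eq : ∀ x ∈ V, (σ x).base = φ x
  jet_eq : ∀ x ∈ V, (σ x).jet = (mfderiv 𝓘(ℝ, E) 𝓘(ℝ, E × F) φ x : E →L[ℝ] (E × F))

/-- `Φ` vanishes on `N` when contracted with any two `π₁`-vertical vectors. -/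
def IsHorizontalOn (Φ : Form (J1Model E F) (J1 E F π) k) (N : Set (J1 E F π)) : Prop :=
  ∀ j ∈ N, ∀ (v : Fin k → J1Model E F) (a b : Fin k), a ≠ b →
    j.dBaseProj (v a) = 0 → j.dBaseProj (v b) = 0 → Φ j v = 0

/-- The pullback of `Φ` by the prolongation of any local section vanishes, on `N`. -/
def IsContactOn (Φ : Form (J1Model E F) (J1 E F π) k) (N : Set (J1 E F π)) : Prop :=
  ∀ (φ : X → Y) (σ : X → J1 E F π) (V : Set X), IsProlongation φ σ V → ∀ x ∈ V, σ x ∈ N →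
    (Φ (σ x)).compContinuousLinearMap
      (mfderiv 𝓘(ℝ, E) 𝓘(ℝ, J1Model E F) σ x : E →L[ℝ] J1Model E F) = 0

/-- On the open set `U`, the module `ℱ` of forms is generated by the `k` smooth forms
`Φ_α = (C_α)^μ_a θᵃ ∧ dⁿx_μ`, which are independent at each point of `U`: the `C^∞(U)`-module
spanned by the restrictions to `U` of the elements of `ℱ` is the one spanned by the `Φ_α`. -/
structure IsLocalGenerators (η : Form E X (n + 1))
    (ℱ : Submodule ℝ (Form (J1Model E F) (J1 E F π) (n + 1))) (U : Set (J1 E F π))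
    (Φ : Fin k → Form (J1Model E F) (J1 E F π) (n + 1)) : Prop where
  isOpen : IsOpen U
  smooth : ∀ α, (Φ α).SmoothOn U
  form : ∀ α, ∀ j ∈ U, ∃ c, Φ α j = contactForm η j c
  independent : ∀ j ∈ U, LinearIndependent ℝ fun α => Φ α j
  generate : ∀ Ψ ∈ ℱ, ∃ f : Fin k → J1 E F π → ℝ, (∀ α, SmoothFunOn (f α) U) ∧
    ∀ j ∈ U, Ψ j = ∑ α, f α j • Φ α j
  mem : ∀ α, ∃ (r : ℕ) (Ψ : Fin r → Form (J1Model E F) (J1 E F π) (n + 1))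
    (f : Fin r → J1 E F π → ℝ), (∀ i, Ψ i ∈ ℱ) ∧ (∀ i, SmoothFunOn (f i) U) ∧
    ∀ j ∈ U, Φ α j = ∑ i, f i j • Ψ i j

/-- A rank `k` submodule `ℱ` of the `C^∞(N)`-module of `n`-horizontal, `1`-contact `(n+1)`-forms on
a neighbourhood `N` of `C`, having independent local generators near each point of `C`. (Only the
values on `N` of the elements of `ℱ` matter.) -/
structure IsConstraintModule (η : Form E X (n + 1)) (C N : Set (J1 E F π)) (k : ℕ)
    (ℱ : Submodule ℝ (Form (J1Model E F) (J1 E F π) (n + 1))) : Prop where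
  isOpen : IsOpen N
  subset : C ⊆ N
  smooth : ∀ Φ ∈ ℱ, Form.SmoothOn Φ N
  smul_mem : ∀ f, SmoothFunOn f N → ∀ Φ ∈ ℱ, (fun j => f j • Φ j) ∈ ℱ
  horizontal : ∀ Φ ∈ ℱ, IsHorizontalOn Φ N
  contact : ∀ Φ ∈ ℱ, IsContactOn Φ N
  exists_generators : ∀ γ ∈ C, ∃ U ⊆ N, γ ∈ U ∧ ∃ Φ : Fin k → _, IsLocalGenerators η ℱ U Φ

/-- The fibre at `γ` of the bundle of constraint forms: the values at `γ` of the elements of `ℱ`. -/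
def constraintBundle (ℱ : Submodule ℝ (Form (J1Model E F) (J1 E F π) (n + 1))) (γ : J1 E F π) :
    Set (J1Model E F [⋀^Fin (n + 1)]→L[ℝ] ℝ) :=
  {ψ | ∃ Φ ∈ ℱ, Φ γ = ψ}

/-- `ζ` is a smooth vector field on `U` with `i_ζ Ω_L = -Φ` on `U`. -/
structure IsConstraintField (η : Form E X (n + 1)) (L : J1 E F π → ℝ) (U : Set (J1 E F π))
    (Φ : Form (J1Model E F) (J1 E F π) (n + 1)) (ζ : J1 E F π → J1Model E F) : Prop where
  smooth : SmoothFieldOn ζ U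
  contract_eq : ∀ j ∈ U, (omegaForm η L j).curryLeft (ζ j) = -Φ j

/-- The distribution on `U` spanned by the vector fields `ζ_α`, at the point `j`. -/
def spanAt (ζ : Fin k → J1 E F π → J1Model E F) (j : J1 E F π) : Submodule ℝ (J1Model E F) :=
  Submodule.span ℝ (range fun α => ζ α j)

end Jets

end FieldTheory

end

open FieldTheory

/-!
The proof rests on one formula, `omegaForm_vlift`: for a vector `Z = Zᵃ_μ ∂/∂yᵃ_μ` tangent to the
fibres of `J¹π → Y`,
`i_Z Ω_L = -(Zᵃ_μ ∂²L/∂yᵃ_μ∂yᵇ_ν) θᵇ ∧ dⁿx_ν`.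
In coordinates, `Θ_L` is annihilated by all such vectors, so `i_Z dΘ_L` is the derivative of `Θ_L`
in the direction of `Z` (`extDeriv_cons_of_apply_cons_eq_zero`). Differentiating `∂L/∂yᵃ_μ` gives
the right-hand side, while the derivatives of `θᵃ` and of `L η` cancel, because
`dx^ν ∧ dⁿx_μ = δ^ν_μ η` (`IsJetChart.fderiv_thetaForm`, `contraction_comp`).

Regularity of `L` means that `Z ↦ Zᵃ_μ ∂²L/∂yᵃ_μ∂yᵇ_ν` is bijective, and a contact form
`C^μ_a θᵃ ∧ dⁿx_μ` determines its coefficients (`contactForm_injective`). Hence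
`i_ζ Ω_L = -C^μ_a θᵃ ∧ dⁿx_μ` has exactly one solution `ζ` vertical over `Y`. It is the only
solution at all, since `Ω_L` has no characteristic vectors when the fibres of `π` have positive
dimension and the base has dimension at least two (`eq_zero_of_omegaForm_curryLeft_eq_zero`); the
fibres do have positive dimension as soon as there is a nonzero contact form. The solution depends smoothly on the
jet, being the solution of an injective linear system with smooth coefficients
(`smoothFieldOn_vlift`).

Finally, local generators span the fibres of the bundle of constraint forms
(`IsLocalGenerators.map_proj`), so the span of the fields `ζ_α` consists of the vertical vectors
whose contraction with `Ω_L` lies in that fibre (`IsLocalGenerators.spanAt_eq`). This description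
does not mention the generators, whence the agreement on overlaps and the global distribution.
-/

noncomputable section

namespace FieldTheory

/-! ### Alternating forms on finite-dimensional spaces -/

section Forms

variable {W : Type*} [NormedAddCommGroup W] [NormedSpace ℝ W] [FiniteDimensional ℝ W] {k : ℕ}

variable (W k) in
/-- The values of an alternating form on all tuples of vectors of a fixed basis. -/
def basisEval : (W [⋀^Fin k]→L[ℝ] ℝ) →L[ℝ] ((Fin k → Fin (Module.finrank ℝ W)) → ℝ) :=
  ContinuousLinearMap.pi fun s =>
    (ContinuousMultilinearMap.apply ℝ (fun _ : Fin k => W) ℝ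
      fun i => Module.finBasis ℝ W (s i)).comp
      (ContinuousAlternatingMap.toContinuousMultilinearMapCLM ℝ)

@[simp]
lemma basisEval_apply (ρ : W [⋀^Fin k]→L[ℝ] ℝ) (s : Fin k → Fin (Module.finrank ℝ W)) :
    basisEval W k ρ s = ρ fun i => Module.finBasis ℝ W (s i) := rfl

lemma basisEval_injective : Function.Injective (basisEval W k) := by
  intro ρ ρ' h
  apply ContinuousAlternatingMap.toAlternatingMap_injective
  refine Module.Basis.ext_alternating (Module.finBasis ℝ W) fun s _ => ?_
  exact congrFun h s

/-- A map with values in alternating forms is smooth if its values on all constant vectors are. -/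
lemma contDiffOn_form {V : Type*} [NormedAddCommGroup V] [NormedSpace ℝ V]
    {f : V → W [⋀^Fin k]→L[ℝ] ℝ} {s : Set V}
    (h : ∀ w, ContDiffOn ℝ ∞ (fun z => f z w) s) : ContDiffOn ℝ ∞ f s := by
  obtain ⟨g, hg⟩ := LinearMap.exists_leftInverse_of_injective
    (basisEval W k).toLinearMap (LinearMap.ker_eq_bot.2 basisEval_injective)
  have hf : f = fun z => LinearMap.toContinuousLinearMap g (basisEval W k (f z)) := by
    funext z
    exact (DFunLike.congr_fun hg (f z)).symm
  rw [hf]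
  refine (ContinuousLinearMap.contDiff _).comp_contDiffOn (contDiffOn_pi.2 fun s => ?_)
  simpa using h _

/-- The solution of a smooth linear system with injective matrix is smooth. -/
lemma contDiffAt_of_apply_eq {V P G : Type*} [NormedAddCommGroup V] [NormedSpace ℝ V]
    [NormedAddCommGroup P] [NormedSpace ℝ P] [FiniteDimensional ℝ P]
    [NormedAddCommGroup G] [NormedSpace ℝ G] [FiniteDimensional ℝ G]
    {A : V → P →L[ℝ] G} {b : V → G} {p : V → P} {z₀ : V}
    (hA : ContDiffAt ℝ ∞ A z₀) (hb : ContDiffAt ℝ ∞ b z₀)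
    (hinj : Function.Injective (A z₀)) (hp : ∀ᶠ z in 𝓝 z₀, A z (p z) = b z) :
    ContDiffAt ℝ ∞ p z₀ := by
  have : CompleteSpace P := FiniteDimensional.complete ℝ P
  obtain ⟨g, hg⟩ := LinearMap.exists_leftInverse_of_injective
    (A z₀ : P →ₗ[ℝ] G) (LinearMap.ker_eq_bot.2 hinj)
  -- `R ∘ A z` is the identity at `z₀`, hence invertible near `z₀`
  set R : G →L[ℝ] P := LinearMap.toContinuousLinearMap g
  have hR : R.comp (A z₀) = ContinuousLinearEquiv.refl ℝ P := by
    ext u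
    exact DFunLike.congr_fun hg u
  have hRA : ContDiffAt ℝ ∞ (fun z => R.comp (A z)) z₀ := contDiffAt_const.clm_comp hA
  have hinv : ContDiffAt ℝ ∞ (fun z => (R.comp (A z)).inverse) z₀ := by
    have h1 := contDiffAt_map_inverse (n := ∞) (ContinuousLinearEquiv.refl ℝ P)
    rw [← hR] at h1
    exact h1.comp z₀ hRA
  refine (hinv.clm_apply ((contDiffAt_const (c := R)).clm_apply hb)).congr_of_eventuallyEq ?_
  have hunit : ∀ᶠ z in 𝓝 z₀, R.comp (A z) ∈ range ((↑) : (P ≃L[ℝ] P) → P →L[ℝ] P) := by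
    apply hRA.continuousAt.eventually_mem
    rw [hR]
    exact ContinuousLinearEquiv.nhds _
  filter_upwards [hp, hunit] with z hz ⟨T, hT⟩
  have h2 : T (p z) = R (b z) := by
    rw [← hz]
    exact DFunLike.congr_fun hT (p z)
  simp only [← hT, ContinuousLinearMap.inverse_equiv]
  exact ((ContinuousLinearEquiv.symm_apply_eq T).2 h2.symm).symm

end Forms

/-! ### The contraction of a volume form with a vector-valued form -/

section Contraction

variable {E V : Type*} [NormedAddCommGroup E] [NormedSpace ℝ E]
  [NormedAddCommGroup V] [NormedSpace ℝ V] {n : ℕ}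

/-- The linear form `u ↦ ρ (u, x₁, …, xₙ)`. -/
def insertFirst (ρ : E [⋀^Fin (n + 1)]→L[ℝ] ℝ) (x : Fin n → E) : E →L[ℝ] ℝ :=
  (ContinuousMultilinearMap.apply ℝ (fun _ : Fin n => E) ℝ x).comp
    ((ContinuousAlternatingMap.toContinuousMultilinearMapCLM ℝ).comp ρ.curryLeft)

@[simp]
lemma insertFirst_apply (ρ : E [⋀^Fin (n + 1)]→L[ℝ] ℝ) (x : Fin n → E) (u : E) :
    insertFirst ρ x u = ρ (Fin.cons u x) := rfl

/-- The linear map `u ↦ ∑ᵢ (-1)ⁱ ρ (u, x₀, …, x̂ᵢ, …, xₙ) θᵢ`. A linear functional `c` on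
`E →L[ℝ] V`, with coefficients `c^μ_a`, sends it to the value of `c^μ_a θᵃ ∧ i_μ ρ` on `n + 1`
vectors with components `θᵢ` in `V` and `xᵢ` in `E`. Keeping the functional apart in this way makes
contact forms independent of a choice of basis. -/
def contraction (ρ : E [⋀^Fin (n + 1)]→L[ℝ] ℝ) (θ : Fin (n + 1) → V) (x : Fin (n + 1) → E) :
    E →L[ℝ] V :=
  ∑ i : Fin (n + 1), (-1 : ℝ) ^ (i : ℕ) • (insertFirst ρ (i.removeNth x)).smulRight (θ i)

lemma contraction_apply (ρ : E [⋀^Fin (n + 1)]→L[ℝ] ℝ) (θ : Fin (n + 1) → V)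
    (x : Fin (n + 1) → E) (u : E) :
    contraction ρ θ x u =
      ∑ i : Fin (n + 1), ((-1 : ℝ) ^ (i : ℕ) * ρ (Fin.cons u (i.removeNth x))) • θ i := by
  simp [contraction, sum_apply, mul_smul]

lemma contraction_sub (ρ : E [⋀^Fin (n + 1)]→L[ℝ] ℝ) (θ θ' : Fin (n + 1) → V)
    (x : Fin (n + 1) → E) :
    contraction ρ (θ - θ') x = contraction ρ θ x - contraction ρ θ' x := by
  ext u
  simp [contraction_apply, smul_sub]

lemma contraction_smul (ρ : E [⋀^Fin (n + 1)]→L[ℝ] ℝ) (t : ℝ) (θ : Fin (n + 1) → V)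
    (x : Fin (n + 1) → E) : contraction ρ (t • θ) x = t • contraction ρ θ x := by
  ext u
  simp [contraction_apply, Finset.smul_sum, smul_comm t]

/-- The contraction is natural with respect to linear isomorphisms of both spaces. -/
lemma contraction_map {E' V' : Type*} [NormedAddCommGroup E'] [NormedSpace ℝ E']
    [NormedAddCommGroup V'] [NormedSpace ℝ V'] (ρ : E [⋀^Fin (n + 1)]→L[ℝ] ℝ)
    (S : E' →L[ℝ] E) (ψ : V →L[ℝ] V') (θ : Fin (n + 1) → V) (x : Fin (n + 1) → E') :
    contraction (ρ.compContinuousLinearMap S) (ψ ∘ θ) x =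
      ψ.comp ((contraction ρ θ (S ∘ x)).comp S) := by
  ext u
  simp only [contraction_apply, ContinuousLinearMap.comp_apply, map_sum, map_smul,
    Function.comp_apply, ContinuousAlternatingMap.compContinuousLinearMap_apply]
  refine Finset.sum_congr rfl fun i _ => ?_
  congr 3
  funext l
  refine Fin.cases ?_ (fun l => ?_) l <;> simp [Fin.removeNth]

lemma alternatizeUncurryFin_smulRight_apply (α : E →L[ℝ] ℝ) (ρ : E [⋀^Fin n]→L[ℝ] ℝ)
    (x : Fin (n + 1) → E) :
    ContinuousAlternatingMap.alternatizeUncurryFin (α.smulRight ρ) x =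
      ∑ i : Fin (n + 1), (-1 : ℝ) ^ (i : ℕ) * (α (x i) * ρ (i.removeNth x)) := by
  simp [ContinuousAlternatingMap.alternatizeUncurryFin_apply]

/-- Cramer's rule, with a form of top degree in the role of the determinant. -/
lemma sum_smul_eq_smul (hdim : Module.finrank ℝ E = n + 1) (ρ : E [⋀^Fin (n + 1)]→L[ℝ] ℝ)
    (x : Fin (n + 1) → E) (u : E) :
    ∑ i : Fin (n + 1), ((-1 : ℝ) ^ (i : ℕ) * ρ (Fin.cons u (i.removeNth x))) • x i = ρ x • u := by
  have : FiniteDimensional ℝ E := .of_finrank_pos (by omega)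
  rw [← sub_eq_zero, ← Module.forall_dual_apply_eq_zero_iff ℝ]
  intro α
  -- the form `α ∧ ρ` has degree `n + 2`, so it vanishes on `(u, x)`
  have h0 : ContinuousAlternatingMap.alternatizeUncurryFin
      ((LinearMap.toContinuousLinearMap α).smulRight ρ) (Fin.cons u x) = 0 := by
    refine AlternatingMap.map_linearDependent
      (ContinuousAlternatingMap.alternatizeUncurryFin
      ((LinearMap.toContinuousLinearMap α).smulRight ρ)).toAlternatingMap _ fun h => ?_
    have := h.fintype_card_le_finrank
    simp [hdim] at this
  rw [alternatizeUncurryFin_smulRight_apply, Fin.sum_univ_succ] at h0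
  have h1 : ∀ i : Fin (n + 1), i.succ.removeNth (Fin.cons u x : Fin (n + 2) → E) =
      Fin.cons u (i.removeNth x) := by
    intro i
    funext l
    refine Fin.cases ?_ (fun l => ?_) l <;> simp [Fin.removeNth]
  have h2 : (0 : Fin (n + 2)).removeNth (Fin.cons u x : Fin (n + 2) → E) = x := by
    funext l
    simp [Fin.removeNth]
  simp only [h1, h2] at h0
  simp only [map_sub, map_sum, map_smul, smul_eq_mul]
  simp only [Fin.val_zero, pow_zero, Fin.cons_zero, Fin.cons_succ, Fin.val_succ, pow_succ,
    LinearMap.coe_toContinuousLinearMap', one_mul] at h0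
  rw [sub_eq_zero, ← sub_eq_zero, ← neg_eq_zero, ← h0, neg_sub, mul_comm, sub_eq_add_neg,
    ← Finset.sum_neg_distrib]
  congr 1
  exact Finset.sum_congr rfl fun i _ => by ring

/-- The contraction of `ρ` with `θᵢ = B xᵢ` is `ρ (x) B`. In components this is the identity
`Bᵃ_ν dx^ν ∧ i_μ ρ = Bᵃ_μ ρ`. -/
lemma contraction_comp (hdim : Module.finrank ℝ E = n + 1) (ρ : E [⋀^Fin (n + 1)]→L[ℝ] ℝ)
    (B : E →L[ℝ] V) (x : Fin (n + 1) → E) : contraction ρ (B ∘ x) x = ρ x • B := by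
  ext u
  rw [contraction_apply]
  simpa using congrArg B (sum_smul_eq_smul hdim ρ x u)

lemma map_cons_cons (ρ : E [⋀^Fin (n + 2)]→L[ℝ] ℝ) (u v : E) (x : Fin n → E) :
    ρ (Fin.cons u (Fin.cons v x : Fin (n + 1) → E)) =
      -ρ (Fin.cons v (Fin.cons u x : Fin (n + 1) → E)) := by
  have h : ρ ((Fin.cons v (Fin.cons u x : Fin (n + 1) → E) : Fin (n + 2) → E) ∘
      Equiv.swap 0 1) = -ρ (Fin.cons v (Fin.cons u x : Fin (n + 1) → E)) :=
    ρ.toAlternatingMap.map_swap _ (show (0 : Fin (n + 2)) ≠ 1 by simp)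
  rw [← h]
  congr 1
  funext l
  refine Fin.cases ?_ (fun l => Fin.cases ?_ (fun l => ?_) l) l
  · simp
  · simp
  · have h5 : Equiv.swap (0 : Fin (n + 2)) 1 l.succ.succ = l.succ.succ :=
      Equiv.swap_apply_of_ne_of_ne (by simp [Fin.ext_iff]) (by simp [Fin.ext_iff])
    simp [h5]

/-- The contraction, in its dependence on the vectors `(θᵢ, xᵢ)`, separates the points of `V × E`
if `V ≠ 0` and `dim E ≥ 2`. -/
lemma eq_zero_of_contraction_cons [Nontrivial V] (hn : 1 ≤ n) (hdim : Module.finrank ℝ E = n + 1)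
    {ρ : E [⋀^Fin (n + 1)]→L[ℝ] ℝ} (hρ : ρ ≠ 0) {b : V} {y : E}
    (h : ∀ (θ : Fin n → V) (x : Fin n → E),
      contraction ρ (Fin.cons b θ : Fin (n + 1) → V) (Fin.cons y x : Fin (n + 1) → E) = 0) :
    b = 0 ∧ y = 0 := by
  obtain ⟨x₀, hx₀⟩ : ∃ x, ρ x ≠ 0 := by
    by_contra! h'
    exact hρ (ContinuousAlternatingMap.ext h')
  obtain ⟨m, rfl⟩ : ∃ m, n = m + 1 := ⟨n - 1, by omega⟩
  -- for `θ = 0` only the first term of the contraction is left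
  have hb : b = 0 := by
    have h1 := DFunLike.congr_fun (h 0 (Fin.tail x₀)) (x₀ 0)
    rw [contraction_apply, Fin.sum_univ_succ] at h1
    have h2 : (Fin.cons (x₀ 0) ((0 : Fin (m + 2)).removeNth
        (Fin.cons y (Fin.tail x₀) : Fin (m + 2) → E)) : Fin (m + 2) → E) = x₀ := by
      funext l
      refine Fin.cases ?_ (fun l => ?_) l <;> simp [Fin.tail]
    rw [h2] at h1
    simpa [hx₀] using h1
  refine ⟨hb, ?_⟩
  subst hb
  obtain ⟨d, hd⟩ := exists_ne (0 : V)
  -- the components `θ = (d, 0, …, 0)` isolate the values of `ρ` on `(u, y, x)`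
  have key : ∀ (u : E) (x : Fin m → E), ρ (Fin.cons u (Fin.cons y x : Fin (m + 1) → E)) = 0 := by
    intro u x
    have h1 := DFunLike.congr_fun
      (h (Fin.cons d 0 : Fin (m + 1) → V) (Fin.cons 0 x : Fin (m + 1) → E)) u
    rw [contraction_apply, Fin.sum_univ_succ, Fin.sum_univ_succ] at h1
    have h2 : (Fin.cons u ((Fin.succ (0 : Fin (m + 1))).removeNth
        (Fin.cons y (Fin.cons 0 x : Fin (m + 1) → E) : Fin (m + 2) → E)) : Fin (m + 2) → E) =
        Fin.cons u (Fin.cons y x : Fin (m + 1) → E) := by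
      congr 1
      funext l
      refine Fin.cases ?_ (fun l => ?_) l <;> simp [Fin.removeNth]
    rw [h2] at h1
    simpa [hd] using h1
  have h3 : ∀ x : Fin (m + 1) → E, ρ (Fin.cons y x) = 0 := by
    intro x
    rw [← Fin.cons_self_tail x, map_cons_cons, key, neg_zero]
  have h6 := sum_smul_eq_smul hdim ρ x₀ y
  simp only [h3, mul_zero, zero_smul, Finset.sum_const_zero] at h6
  exact (smul_eq_zero.1 h6.symm).resolve_left hx₀

end Contraction

section Jets

variable {E F : Type*} [NormedAddCommGroup E] [NormedSpace ℝ E]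
  [NormedAddCommGroup F] [NormedSpace ℝ F]
  {X Y : Type*} [TopologicalSpace X] [ChartedSpace E X] [TopologicalSpace Y]
  [ChartedSpace (E × F) Y] {π : Y → X} [IsManifold 𝓘(ℝ, E × F) ∞ Y] [IsFibredManifold E F π]

/-! ### The jet bundle in coordinates -/

/-- `q` is the chart `(x, y, y_x)` of the jet bundle induced by the adapted charts `e` and `c`. The
jet `j₀` is the value which the inverse of `q` takes outside its domain. -/
structure IsJetChart (q : OpenPartialHomeomorph (J1 E F π) (J1Model E F))
    (e : OpenPartialHomeomorph Y (E × F)) (c : OpenPartialHomeomorph X E) : Prop where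
  mem : q ∈ IsManifold.maximalAtlas 𝓘(ℝ, J1Model E F) ∞ (J1 E F π)
  adapted : IsAdapted π e c
  eq : ∃ j₀, q.toPartialEquiv = adapted.jetChart j₀

lemma exists_isJetChart (j₀ : J1 E F π) :
    ∃ e c, IsJetChart (chartAt (J1Model E F) j₀) e c :=
  ⟨_, _, IsManifold.chart_mem_maximalAtlas j₀, (exists_isAdapted π j₀.base).choose_spec.2, j₀, rfl⟩

variable {q : OpenPartialHomeomorph (J1 E F π) (J1Model E F)}
  {e : OpenPartialHomeomorph Y (E × F)} {c : OpenPartialHomeomorph X E}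

namespace IsJetChart

lemma mem_source (hq : IsJetChart q e c) {j : J1 E F π} : j ∈ q.source ↔ j.base ∈ e.source := by
  obtain ⟨j₀, h⟩ := hq.eq
  rw [h]
  rfl

lemma mem_target (hq : IsJetChart q e c) {z : J1Model E F} : z ∈ q.target ↔ z.1 ∈ e.target := by
  obtain ⟨j₀, h⟩ := hq.eq
  rw [h]
  rfl

lemma apply_eq (hq : IsJetChart q e c) (j : J1 E F π) :
    q j = (e j.base, (ContinuousLinearMap.snd ℝ E F).comp
      ((dChart e j.base).comp (j.jet.comp (dChartSymm c (c (π j.base)))))) := by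
  obtain ⟨j₀, h⟩ := hq.eq
  change q.toPartialEquiv j = _
  rw [h]
  rfl

lemma fst_fst (hq : IsJetChart q e c) {j : J1 E F π} (hj : j ∈ q.source) :
    (q j).1.1 = c (π j.base) := by
  rw [hq.apply_eq]
  exact hq.adapted.fst_eq _ (hq.mem_source.1 hj)

lemma proj_source (hq : IsJetChart q e c) {j : J1 E F π} (hj : j ∈ q.source) :
    π j.base ∈ c.source :=
  hq.adapted.mapsTo (hq.mem_source.1 hj)

lemma dBase_eq (hq : IsJetChart q e c) {j : J1 E F π} (hj : j ∈ q.source) :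
    j.dBase = (dChartSymm e (e j.base)).comp
      ((ContinuousLinearMap.fst ℝ (E × F) (E →L[ℝ] F)).comp (dChart q j)) := by
  have hev : (J1.base : J1 E F π → Y) =ᶠ[𝓝 j] e.symm ∘ (Prod.fst ∘ q) := by
    filter_upwards [q.open_source.mem_nhds hj] with w hw
    simp [hq.apply_eq w, hq.mem_source.1 hw]
  have h1 := mdifferentiableAt_chart hq.mem hj
  have hfst : MDifferentiableAt 𝓘(ℝ, J1Model E F) 𝓘(ℝ, E × F)
      (Prod.fst : J1Model E F → E × F) (q j) := differentiableAt_fst.mdifferentiableAt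
  have h5 : (Prod.fst ∘ q) j = e j.base := congrArg Prod.fst (hq.apply_eq j)
  have h2 : MDifferentiableAt 𝓘(ℝ, E × F) 𝓘(ℝ, E × F) e.symm ((Prod.fst ∘ q) j) := by
    apply mdifferentiableAt_chart_symm hq.adapted.mem_left
    rw [h5]
    exact e.map_source (hq.mem_source.1 hj)
  have h3 : mfderiv 𝓘(ℝ, J1Model E F) 𝓘(ℝ, E × F) (Prod.fst : J1Model E F → E × F) (q j)
      = ContinuousLinearMap.fst ℝ (E × F) (E →L[ℝ] F) := by
    rw [mfderiv_eq_fderiv, fderiv_fst]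
  have h4 := mfderiv_comp j h2 (hfst.comp j h1)
  rw [mfderiv_comp j hfst h1, h3, h5] at h4
  unfold J1.dBase
  rw [hev.mfderiv_eq]
  exact h4

lemma dBaseProj_eq (hq : IsJetChart q e c) {j : J1 E F π} (hj : j ∈ q.source) :
    j.dBaseProj = (dChartSymm c (c (π j.base))).comp ((ContinuousLinearMap.fst ℝ E F).comp
      ((ContinuousLinearMap.fst ℝ (E × F) (E →L[ℝ] F)).comp (dChart q j))) := by
  have hj' := hq.mem_source.1 hj
  rw [J1.dBaseProj, hq.dBase_eq hj, hq.adapted.dProj_eq hj']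
  refine ContinuousLinearMap.ext fun v => ?_
  have h1 := DFunLike.congr_fun (dChart_comp_dChartSymm hq.adapted.mem_left hj')
    (dChart q j v).1
  simp only [ContinuousLinearMap.comp_apply, ContinuousLinearMap.id_apply] at h1 ⊢
  exact congrArg (fun a => dChartSymm c (c (π j.base)) a.1) h1

/-- The coordinates `δx^μ` of tangent vectors of `X` at `π j.base`. -/
def horEquiv (hq : IsJetChart q e c) {j : J1 E F π} (hj : j ∈ q.source) : E ≃L[ℝ] E :=
  ContinuousLinearEquiv.equivOfInverse (dChart c (π j.base)) (dChartSymm c (c (π j.base)))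
    (fun u => DFunLike.congr_fun
      (dChartSymm_comp_dChart hq.adapted.mem_right (hq.proj_source hj)) u)
    (fun u => DFunLike.congr_fun
      (dChart_comp_dChartSymm hq.adapted.mem_right (hq.proj_source hj)) u)

lemma horEquiv_symm_eq (hq : IsJetChart q e c) {j : J1 E F π} (hj : j ∈ q.source) :
    ((hq.horEquiv hj).symm : E →L[ℝ] E) = dChartSymm c (c (π j.base)) := rfl

lemma horEquiv_dBaseProj (hq : IsJetChart q e c) {j : J1 E F π} (hj : j ∈ q.source)
    (v : J1Model E F) : hq.horEquiv hj (j.dBaseProj v) = (dChart q j v).1.1 := by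
  rw [hq.dBaseProj_eq hj]
  exact (hq.horEquiv hj).apply_symm_apply _

lemma dChart_fst_vert (hq : IsJetChart q e c) {j : J1 E F π} (hj : j ∈ q.source) (b : E × F) :
    (dChart e j.base b).1 = hq.horEquiv hj (dProj E F π j.base b) := by
  rw [hq.adapted.dProj_eq (hq.mem_source.1 hj)]
  exact ((hq.horEquiv hj).apply_symm_apply _).symm

/-- The coordinates `δyᵃ` of `π`-vertical tangent vectors of `Y` at `j.base`. -/
def vertEquiv (hq : IsJetChart q e c) {j : J1 E F π} (hj : j ∈ q.source) : j.Vert ≃L[ℝ] F :=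
  ContinuousLinearEquiv.equivOfInverse
    ((ContinuousLinearMap.snd ℝ E F).comp ((dChart e j.base).comp j.Vert.subtypeL))
    (((dChartSymm e (e j.base)).comp (ContinuousLinearMap.inr ℝ E F)).codRestrict j.Vert (by
      intro b
      have h1 := DFunLike.congr_fun (dChart_comp_dChartSymm hq.adapted.mem_left
        (hq.mem_source.1 hj)) ((0 : E), b)
      have h2 := hq.dChart_fst_vert hj (dChartSymm e (e j.base) ((0 : E), b))
      simp only [ContinuousLinearMap.comp_apply, ContinuousLinearMap.id_apply] at h1
      rw [h1] at h2
      exact (hq.horEquiv hj).injective (h2.symm.trans (map_zero _).symm)))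
    (fun b => by
      have h1 := DFunLike.congr_fun (dChartSymm_comp_dChart hq.adapted.mem_left
        (hq.mem_source.1 hj)) (b : E × F)
      have h2 := hq.dChart_fst_vert hj (b : E × F)
      rw [show dProj E F π j.base (b : E × F) = 0 from b.2, map_zero] at h2
      apply Subtype.ext
      simp only [ContinuousLinearMap.comp_apply, ContinuousLinearMap.id_apply] at h1
      conv_rhs => rw [← h1]
      exact congrArg (dChartSymm e (e j.base)) (Prod.ext h2.symm rfl))
    (fun b => by
      have h1 := DFunLike.congr_fun (dChart_comp_dChartSymm hq.adapted.mem_left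
        (hq.mem_source.1 hj)) ((0 : E), b)
      exact congrArg Prod.snd h1)

lemma vertEquiv_apply (hq : IsJetChart q e c) {j : J1 E F π} (hj : j ∈ q.source) (b : j.Vert) :
    hq.vertEquiv hj b = (dChart e j.base (b : E × F)).2 := rfl

/-- The coordinates `Bᵃ_μ` of vectors tangent to the fibres of `J¹π → Y`. -/
def fibreEquiv (hq : IsJetChart q e c) {j : J1 E F π} (hj : j ∈ q.source) :
    (E →L[ℝ] j.Vert) ≃L[ℝ] (E →L[ℝ] F) :=
  (hq.horEquiv hj).arrowCongr (hq.vertEquiv hj)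

lemma fibreEquiv_eq (hq : IsJetChart q e c) {j : J1 E F π} (hj : j ∈ q.source)
    (B : E →L[ℝ] j.Vert) :
    hq.fibreEquiv hj B = (hq.vertEquiv hj : j.Vert →L[ℝ] F).comp
      (B.comp ((hq.horEquiv hj).symm : E →L[ℝ] E)) := by
  ext u
  rfl

lemma vertEquiv_contact (hq : IsJetChart q e c) {j : J1 E F π} (hj : j ∈ q.source)
    (v : J1Model E F) :
    hq.vertEquiv hj (j.contact v) = (dChart q j v).1.2 - (q j).2 (dChart q j v).1.1 := by
  have h1 := DFunLike.congr_fun (dChart_comp_dChartSymm hq.adapted.mem_left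
    (hq.mem_source.1 hj)) (dChart q j v).1
  have h2 : ((j.contact v : j.Vert) : E × F) = j.dBase v - j.jet (j.dBaseProj v) := rfl
  rw [vertEquiv_apply, h2, map_sub, Prod.snd_sub, hq.dBase_eq hj, hq.dBaseProj_eq hj,
    hq.apply_eq j]
  exact congrArg (fun a => Prod.snd a - _) h1

lemma translate_mem (hq : IsJetChart q e c) {j : J1 E F π} (hj : j ∈ q.source)
    (B : E →L[ℝ] j.Vert) : j.translate B ∈ q.source :=
  hq.mem_source.2 (show j.base ∈ e.source from hq.mem_source.1 hj)

lemma apply_translate (hq : IsJetChart q e c) {j : J1 E F π} (hj : j ∈ q.source)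
    (B : E →L[ℝ] j.Vert) :
    q (j.translate B) = q j + ((0 : E × F), hq.fibreEquiv hj B) := by
  rw [hq.apply_eq, hq.apply_eq]
  refine Prod.ext (by simp [J1.translate]) ?_
  ext u
  have h : dChart e (j.translate B).base = dChart e j.base := rfl
  simp only [h]
  simp [J1.translate, fibreEquiv_eq, vertEquiv_apply, ← horEquiv_symm_eq hq hj]

/-- In coordinates, the affine structure of the fibres of `J¹π → Y` is the one of the model
space. -/
lemma translate_eq (hq : IsJetChart q e c) {j : J1 E F π} (hj : j ∈ q.source)
    (B : E →L[ℝ] j.Vert) :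
    j.translate B = q.symm (q j + ((0 : E × F), hq.fibreEquiv hj B)) := by
  rw [← hq.apply_translate hj, q.left_inv (hq.translate_mem hj B)]

/-- The vectors `Bᵃ_μ ∂/∂yᵃ_μ` in the model space: the derivative of `B ↦ q (j.translate B)`. -/
def fibreIncl (hq : IsJetChart q e c) {j : J1 E F π} (hj : j ∈ q.source) :
    (E →L[ℝ] j.Vert) →L[ℝ] J1Model E F :=
  (ContinuousLinearMap.inr ℝ (E × F) (E →L[ℝ] F)).comp
    (hq.fibreEquiv hj : (E →L[ℝ] j.Vert) →L[ℝ] (E →L[ℝ] F))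

lemma fibreIncl_apply (hq : IsJetChart q e c) {j : J1 E F π} (hj : j ∈ q.source)
    (B : E →L[ℝ] j.Vert) : hq.fibreIncl hj B = ((0 : E × F), hq.fibreEquiv hj B) := rfl

lemma hasFDerivAt_fibre (hq : IsJetChart q e c) {j : J1 E F π} (hj : j ∈ q.source)
    (B : E →L[ℝ] j.Vert) :
    HasFDerivAt (fun B => q j + ((0 : E × F), hq.fibreEquiv hj B)) (hq.fibreIncl hj) B :=
  (hq.fibreIncl hj).hasFDerivAt.const_add (q j)

lemma vlift_eq (hq : IsJetChart q e c) {j : J1 E F π} (hj : j ∈ q.source) :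
    j.vlift = (dChartSymm q (q j)).comp (hq.fibreIncl hj) := by
  have hfun : j.translate = q.symm ∘ (fun B => q j + ((0 : E × F), hq.fibreEquiv hj B)) :=
    funext (hq.translate_eq hj)
  have h0 : q j + ((0 : E × F), hq.fibreEquiv hj 0) = q j := by simp
  have h1 : MDifferentiableAt 𝓘(ℝ, J1Model E F) 𝓘(ℝ, J1Model E F) q.symm
      (q j + ((0 : E × F), hq.fibreEquiv hj 0)) := by
    rw [h0]
    exact mdifferentiableAt_chart_symm hq.mem (q.map_source hj)
  have h2 := mfderiv_comp (I := 𝓘(ℝ, E →L[ℝ] j.Vert)) (0 : E →L[ℝ] j.Vert) h1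
    (hq.hasFDerivAt_fibre hj 0).differentiableAt.mdifferentiableAt
  rw [mfderiv_eq_fderiv, (hq.hasFDerivAt_fibre hj 0).fderiv] at h2
  unfold J1.vlift
  rw [hfun, h2, h0]
  rfl

lemma dChart_vlift (hq : IsJetChart q e c) {j : J1 E F π} (hj : j ∈ q.source)
    (B : E →L[ℝ] j.Vert) : dChart q j (j.vlift B) = ((0 : E × F), hq.fibreEquiv hj B) := by
  rw [hq.vlift_eq hj]
  exact DFunLike.congr_fun (dChart_comp_dChartSymm hq.mem hj) _

lemma dChart_injective (hq : IsJetChart q e c) {j : J1 E F π} (hj : j ∈ q.source) :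
    Function.Injective (dChart q j) :=
  Function.LeftInverse.injective (g := dChartSymm q (q j)) fun v =>
    DFunLike.congr_fun (dChartSymm_comp_dChart hq.mem hj) v

lemma dChart_dChartSymm_apply (hq : IsJetChart q e c) {j : J1 E F π} (hj : j ∈ q.source)
    (v : J1Model E F) : dChart q j (dChartSymm q (q j) v) = v :=
  DFunLike.congr_fun (dChart_comp_dChartSymm hq.mem hj) v

end IsJetChart

namespace J1

lemma dBase_vlift (j : J1 E F π) (B : E →L[ℝ] j.Vert) : j.dBase (j.vlift B) = 0 := by
  obtain ⟨e, c, hq⟩ := exists_isJetChart j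
  have hj := mem_chart_source (J1Model E F) j
  rw [hq.dBase_eq hj]
  simp [hq.dChart_vlift hj]

/-- The vertical lifts are the common kernel of the contact form and of the differential of
`π₁`. -/
lemma exists_vlift_eq {j : J1 E F π} {v : J1Model E F} (h : j.dBaseProj v = 0)
    (h' : j.contact v = 0) : ∃ B, j.vlift B = v := by
  obtain ⟨e, c, hq⟩ := exists_isJetChart j
  have hj := mem_chart_source (J1Model E F) j
  have h1 := hq.horEquiv_dBaseProj hj v
  have h2 := hq.vertEquiv_contact hj v
  rw [h, map_zero] at h1
  rw [h', map_zero, ← h1, map_zero, sub_zero] at h2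
  refine ⟨(hq.fibreEquiv hj).symm (dChart (chartAt (J1Model E F) j) j v).2,
    hq.dChart_injective hj ?_⟩
  rw [hq.dChart_vlift hj, ContinuousLinearEquiv.apply_symm_apply]
  exact Prod.ext (Prod.ext h1 h2) rfl

lemma exists_vlift_eq_of_dBase {j : J1 E F π} {v : J1Model E F} (h : j.dBase v = 0) :
    ∃ B, j.vlift B = v := by
  have h1 : j.dBaseProj v = 0 := by simp [dBaseProj, h]
  refine exists_vlift_eq h1 (Subtype.ext ?_)
  change j.dBase v - j.jet (j.dBaseProj v) = 0
  simp [h, h1]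

lemma vlift_injective (j : J1 E F π) : Function.Injective j.vlift := by
  obtain ⟨e, c, hq⟩ := exists_isJetChart j
  have hj := mem_chart_source (J1Model E F) j
  intro B B' h
  have h1 := congrArg (dChart (chartAt (J1Model E F) j) j) h
  rw [hq.dChart_vlift hj, hq.dChart_vlift hj] at h1
  exact (hq.fibreEquiv hj).injective (congrArg Prod.snd h1)

/-- Tangent vectors with given contact and horizontal components exist. -/
lemma exists_contact_eq (j : J1 E F π) (b : j.Vert) (x : E) :
    ∃ v, j.contact v = b ∧ j.dBaseProj v = x := by
  obtain ⟨e, c, hq⟩ := exists_isJetChart j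
  have hj := mem_chart_source (J1Model E F) j
  set q := chartAt (J1Model E F) j
  refine ⟨dChartSymm q (q j) ((hq.horEquiv hj x,
    hq.vertEquiv hj b + (q j).2 (hq.horEquiv hj x)), 0),
    (hq.vertEquiv hj).injective ?_, (hq.horEquiv hj).injective ?_⟩
  · rw [hq.vertEquiv_contact hj, hq.dChart_dChartSymm_apply hj]
    simp
  · rw [hq.horEquiv_dBaseProj hj, hq.dChart_dChartSymm_apply hj]

end J1

end Jets

/-! ### Forms in coordinates -/

section Manifolds

variable {W : Type*} [NormedAddCommGroup W] [NormedSpace ℝ W]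
  {M : Type*} [TopologicalSpace M] [ChartedSpace W M] {k : ℕ}

/-- The coordinate expression of a form in an arbitrary chart. -/
def Form.inCoord (Φ : Form W M k) (e : OpenPartialHomeomorph M W) : W → W [⋀^Fin k]→L[ℝ] ℝ :=
  fun z => (Φ (e.symm z)).compContinuousLinearMap (dChartSymm e z)

lemma Form.inCoord_apply_chart (Φ : Form W M k) {e : OpenPartialHomeomorph M W} {j : M}
    (hj : j ∈ e.source) (w : Fin k → W) :
    Φ.inCoord e (e j) w = Φ j (dChartSymm e (e j) ∘ w) := by
  simp [Form.inCoord, e.left_inv hj]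

lemma contDiffAt_apply_comp {V : Type*} [NormedAddCommGroup V] [NormedSpace ℝ V]
    {f : V → W [⋀^Fin k]→L[ℝ] ℝ} {A : V → W →L[ℝ] W} {z : V}
    (hf : ContDiffAt ℝ ∞ f z) (hA : ContDiffAt ℝ ∞ A z) (w : Fin k → W) :
    ContDiffAt ℝ ∞ (fun z => f z (A z ∘ w)) z := by
  have h1 : ContDiffAt ℝ ∞ (fun z =>
      ContinuousMultilinearMap.compContinuousLinearMapContinuousMultilinear
        ℝ (fun _ : Fin k => W) (fun _ : Fin k => W) ℝ (fun _ => A z)) z :=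
    (ContinuousMultilinearMap.contDiff _).contDiffAt.comp z (contDiffAt_pi.2 fun _ => hA)
  have h2 : ContDiffAt ℝ ∞ (fun z =>
      ContinuousAlternatingMap.toContinuousMultilinearMapCLM (F := ℝ) ℝ (f z)) z :=
    (ContinuousLinearMap.contDiff _).contDiffAt.comp z hf
  exact (ContinuousLinearMap.contDiff (ContinuousMultilinearMap.apply ℝ
    (fun _ : Fin k => W) ℝ w)).contDiffAt.comp z (h1.clm_apply h2)

/-- A smooth form has a smooth expression in every chart of the maximal atlas. -/
lemma Form.SmoothOn.contDiffOn_inCoord [FiniteDimensional ℝ W] [IsManifold 𝓘(ℝ, W) ∞ M]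
    {Φ : Form W M k} (hΦ : Φ.SmoothOn univ)
    {e : OpenPartialHomeomorph M W} (he : e ∈ IsManifold.maximalAtlas 𝓘(ℝ, W) ∞ M) :
    ContDiffOn ℝ ∞ (Φ.inCoord e) e.target := by
  refine contDiffOn_form fun w z₀ hz₀ => ContDiffAt.contDiffWithinAt ?_
  -- near `z₀` the expression in `e` is the pullback by the change of charts `e' ∘ e⁻¹` of the
  -- expression in the preferred chart `e'`
  set e' := chartAt W (e.symm z₀)
  have he' : e' ∈ IsManifold.maximalAtlas 𝓘(ℝ, W) ∞ M :=
    IsManifold.chart_mem_maximalAtlas _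
  have hmem : z₀ ∈ (e.symm.trans e').source := by
    simpa [e'] using hz₀
  have hopen : IsOpen (e.symm.trans e').source := (e.symm.trans e').open_source
  have hτ : ContDiffOn ℝ ∞ (e' ∘ e.symm) (e.symm.trans e').source := by
    rw [← contMDiffOn_iff_contDiffOn]
    exact (contMDiffOn_of_mem_maximalAtlas he').comp
      ((contMDiffOn_symm_of_mem_maximalAtlas he).mono (fun z hz => hz.1)) (fun z hz => hz.2)
  have hτ' : ContDiffOn ℝ ∞ (fderiv ℝ (e' ∘ e.symm)) (e.symm.trans e').source :=
    hτ.fderiv_of_isOpen hopen (by simp)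
  have h1 : ContDiffAt ℝ ∞ (Φ.inChart (e.symm z₀)) ((e' ∘ e.symm) z₀) := by
    have h2 := hΦ (e.symm z₀)
    rw [preimage_univ, inter_univ] at h2
    exact h2.contDiffAt (e'.open_target.mem_nhds (e'.map_source hmem.2))
  have h3 := contDiffAt_apply_comp
    (h1.comp z₀ (hτ.contDiffAt (hopen.mem_nhds hmem)))
    (hτ'.contDiffAt (hopen.mem_nhds hmem)) w
  refine h3.congr_of_eventuallyEq ?_
  filter_upwards [hopen.mem_nhds hmem] with z hz
  have hz2 : e.symm z ∈ e'.source := hz.2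
  have h4 := dChartSymm_comp_dChart he' hz2
  have h5 := dChart_comp_dChartSymm_eq he he' hz.1 hz2
  have h6 := Form.inCoord_apply_chart Φ hz2 (fderiv ℝ (e' ∘ e.symm) z ∘ w)
  refine Eq.trans ?_ h6.symm
  rw [← h5]
  change Φ (e.symm z) _ = Φ (e.symm z) _
  congr 1
  funext i
  exact (DFunLike.congr_fun h4 (dChartSymm e z (w i))).symm

lemma fderiv_apply_form {σ : W → W [⋀^Fin k]→L[ℝ] ℝ} {z : W} (hσ : DifferentiableAt ℝ σ z)
    (v : W) (w : Fin k → W) : fderiv ℝ σ z v w = fderiv ℝ (fun z => σ z w) z v := by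
  have h := (hσ.hasFDerivAt.continuousAlternatingMap_apply_const w).fderiv
  rw [h]
  rfl

/-- For a constant field `v` annihilating the form `σ`, the contraction `i_v dσ` is the
derivative of `σ` along `v`. -/
lemma extDeriv_cons_of_apply_cons_eq_zero {n : ℕ} {σ : W → W [⋀^Fin (n + 1)]→L[ℝ] ℝ} {z v : W}
    (hσ : DifferentiableAt ℝ σ z) (hv : ∀ᶠ z' in 𝓝 z, ∀ u : Fin n → W, σ z' (Fin.cons v u) = 0)
    (w : Fin (n + 1) → W) : extDeriv σ z (Fin.cons v w) = fderiv ℝ σ z v w := by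
  rw [extDeriv, ContinuousAlternatingMap.alternatizeUncurryFin_apply, Fin.sum_univ_succ]
  -- the other terms of the exterior derivative differentiate functions `σ (v, …)`, which vanish
  have h1 : ∀ i : Fin (n + 1), fderiv ℝ σ z ((Fin.cons v w : Fin (n + 2) → W) i.succ)
      (i.succ.removeNth (Fin.cons v w : Fin (n + 2) → W)) = 0 := by
    intro i
    have h2 : i.succ.removeNth (Fin.cons v w : Fin (n + 2) → W) =
        Fin.cons v (i.removeNth w) := by
      funext l
      refine Fin.cases ?_ (fun l => ?_) l <;> simp [Fin.removeNth]
    have h3 : (fun z => σ z (Fin.cons v (i.removeNth w))) =ᶠ[𝓝 z] fun _ => 0 :=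
      hv.mono fun z' hz' => hz' _
    rw [h2, fderiv_apply_form hσ, h3.fderiv_eq]
    simp
  have h4 : (0 : Fin (n + 2)).removeNth (Fin.cons v w : Fin (n + 2) → W) = w := by
    funext l
    simp [Fin.removeNth]
  simp only [h1, h4]
  simp

end Manifolds

section Jets

variable {E F : Type*} [NormedAddCommGroup E] [NormedSpace ℝ E]
  [NormedAddCommGroup F] [NormedSpace ℝ F]
  {X Y : Type*} [TopologicalSpace X] [ChartedSpace E X] [TopologicalSpace Y]
  [ChartedSpace (E × F) Y] {π : Y → X} [IsManifold 𝓘(ℝ, E × F) ∞ Y] [IsFibredManifold E F π]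
  {q : OpenPartialHomeomorph (J1 E F π) (J1Model E F)}
  {e : OpenPartialHomeomorph Y (E × F)} {c : OpenPartialHomeomorph X E}
  {L : J1 E F π → ℝ} {n : ℕ}

/-! ### The derivatives of the Lagrangian in coordinates -/

lemma SmoothFunOn.contDiffOn_comp_symm (hL : SmoothFunOn L univ) (hq : IsJetChart q e c) :
    ContDiffOn ℝ ∞ (L ∘ q.symm) q.target := by
  rw [← contMDiffOn_iff_contDiffOn]
  exact ContMDiffOn.comp hL (contMDiffOn_symm_of_mem_maximalAtlas hq.mem) (fun _ _ => mem_univ _)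

lemma SmoothFunOn.contDiffOn_fderiv_comp_symm (hL : SmoothFunOn L univ) (hq : IsJetChart q e c) :
    ContDiffOn ℝ ∞ (fderiv ℝ (L ∘ q.symm)) q.target :=
  (hL.contDiffOn_comp_symm hq).fderiv_of_isOpen q.open_target (by simp)

lemma IsJetChart.dFun_vlift (hq : IsJetChart q e c) (hL : SmoothFunOn L univ) {j : J1 E F π}
    (hj : j ∈ q.source) (B : E →L[ℝ] j.Vert) :
    dFun L j (j.vlift B) = fderiv ℝ (L ∘ q.symm) (q j) ((0 : E × F), hq.fibreEquiv hj B) := by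
  have hev : L =ᶠ[𝓝 j] (L ∘ q.symm) ∘ q := by
    filter_upwards [q.open_source.mem_nhds hj] with w hw
    simp [q.left_inv hw]
  have h1 : DifferentiableAt ℝ (L ∘ q.symm) (q j) :=
    ((hL.contDiffOn_comp_symm hq).contDiffAt
      (q.open_target.mem_nhds (q.map_source hj))).differentiableAt (by simp)
  have h2 := mfderiv_comp j h1.mdifferentiableAt (mdifferentiableAt_chart hq.mem hj)
  rw [mfderiv_eq_fderiv] at h2
  rw [← hq.dChart_vlift hj]
  unfold dFun
  rw [hev.mfderiv_eq, h2]
  rfl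

lemma IsJetChart.hessian_eq (hq : IsJetChart q e c) (hL : SmoothFunOn L univ) {j : J1 E F π}
    (hj : j ∈ q.source) (B B' : E →L[ℝ] j.Vert) :
    hessian L j B B' = fderiv ℝ (fderiv ℝ (L ∘ q.symm)) (q j)
      ((0 : E × F), hq.fibreEquiv hj B) ((0 : E × F), hq.fibreEquiv hj B') := by
  have hmem : ∀ B : E →L[ℝ] j.Vert, q j + ((0 : E × F), hq.fibreEquiv hj B) ∈ q.target := by
    intro B
    rw [← hq.apply_translate hj]
    exact q.map_source (hq.translate_mem hj B)
  have h1 : (fun B => L (j.translate B)) =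
      fun B => (L ∘ q.symm) (q j + ((0 : E × F), hq.fibreEquiv hj B)) :=
    funext fun B => congrArg L (hq.translate_eq hj B)
  have h2 : fderiv ℝ (fun B => L (j.translate B)) = fun B =>
      (fderiv ℝ (L ∘ q.symm) (q j + ((0 : E × F), hq.fibreEquiv hj B))).comp
        (hq.fibreIncl hj) := by
    funext B
    rw [h1]
    have h3 : DifferentiableAt ℝ (L ∘ q.symm) (q j + ((0 : E × F), hq.fibreEquiv hj B)) :=
      ((hL.contDiffOn_comp_symm hq).contDiffAt
        (q.open_target.mem_nhds (hmem B))).differentiableAt (by simp)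
    exact (h3.hasFDerivAt.comp B (hq.hasFDerivAt_fibre hj B)).fderiv
  have h4 : DifferentiableAt ℝ (fderiv ℝ (L ∘ q.symm))
      (q j + ((0 : E × F), hq.fibreEquiv hj 0)) :=
    ((hL.contDiffOn_fderiv_comp_symm hq).contDiffAt
      (q.open_target.mem_nhds (hmem 0))).differentiableAt (by simp)
  have h5 := ((h4.hasFDerivAt.comp (0 : E →L[ℝ] j.Vert) (hq.hasFDerivAt_fibre hj 0)).clm_comp
    (hasFDerivAt_const (hq.fibreIncl hj) (0 : E →L[ℝ] j.Vert))).fderiv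
  have h6 : q j + ((0 : E × F), hq.fibreEquiv hj 0) = q j := by simp
  unfold hessian
  rw [h2]
  refine (congrArg (fun T => T B B') h5).trans ?_
  rw [h6]
  simp [hq.fibreIncl_apply]

/-! ### The Poincaré–Cartan form in coordinates -/

/-- The contraction of the volume form `ρ` with the contact form `θᵃ = dyᵃ - yᵃ_ν dx^ν`, in the
coordinates `z = (x, y, y_x)` of the jet bundle. -/
def coordContraction (ρ : E → E [⋀^Fin (n + 1)]→L[ℝ] ℝ) (z : J1Model E F)
    (w : Fin (n + 1) → J1Model E F) : E →L[ℝ] F :=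
  contraction (ρ z.1.1) (fun i => (w i).1.2 - z.2 (w i).1.1) (fun i => (w i).1.1)

/-- The dependence of the contraction on `y_x`; the second term comes from
`dx^ν ∧ dⁿx_μ = δ^ν_μ ρ`. -/
lemma coordContraction_add (hdim : Module.finrank ℝ E = n + 1)
    (ρ : E → E [⋀^Fin (n + 1)]→L[ℝ] ℝ) (z : J1Model E F) (w : Fin (n + 1) → J1Model E F)
    (P : E →L[ℝ] F) (t : ℝ) :
    coordContraction ρ (z + t • ((0 : E × F), P)) w =
      coordContraction ρ z w - t • ρ z.1.1 (fun i => (w i).1.1) • P := by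
  have h := contraction_comp hdim (ρ z.1.1) P (fun i => (w i).1.1)
  rw [coordContraction, coordContraction, ← h, ← contraction_smul, ← contraction_sub]
  have h1 : (z + t • ((0 : E × F), P)).1.1 = z.1.1 := by simp
  rw [h1]
  congr 1
  funext i
  simp [sub_sub]

lemma contraction_cons_zero (ρ : E [⋀^Fin (n + 1)]→L[ℝ] ℝ) (θ : Fin (n + 1) → F)
    (x : Fin (n + 1) → E) (hθ : θ 0 = 0) (hx : x 0 = 0) : contraction ρ θ x = 0 := by
  ext u
  rw [contraction_apply]
  refine Finset.sum_eq_zero fun i _ => ?_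
  obtain rfl | hi := eq_or_ne i 0
  · simp [hθ]
  · obtain ⟨l, hl⟩ := Fin.exists_succAbove_eq hi.symm
    rw [ρ.map_coord_zero l.succ (by simp [Fin.removeNth, hl, hx])]
    simp

/-- The contraction with the contact form on the jet bundle, expressed in coordinates. -/
lemma IsJetChart.coordContraction_eq (hq : IsJetChart q e c) (η : Form E X (n + 1))
    {j : J1 E F π} (hj : j ∈ q.source) (w : Fin (n + 1) → J1Model E F) :
    coordContraction (η.inCoord c) (q j) w = hq.fibreEquiv hj
      (contraction (η (π j.base)) (j.contact ∘ dChartSymm q (q j) ∘ w)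
        (j.dBaseProj ∘ dChartSymm q (q j) ∘ w)) := by
  have h1 : (fun i => (w i).1.2 - (q j).2 (w i).1.1) =
      (hq.vertEquiv hj : j.Vert →L[ℝ] F) ∘ (j.contact ∘ dChartSymm q (q j) ∘ w) := by
    funext i
    have := hq.vertEquiv_contact hj (dChartSymm q (q j) (w i))
    rw [hq.dChart_dChartSymm_apply hj] at this
    exact this.symm
  have h2 : j.dBaseProj ∘ dChartSymm q (q j) ∘ w =
      ((hq.horEquiv hj).symm : E →L[ℝ] E) ∘ (fun i => (w i).1.1) := by
    funext i
    have := hq.horEquiv_dBaseProj hj (dChartSymm q (q j) (w i))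
    rw [hq.dChart_dChartSymm_apply hj] at this
    exact ((hq.horEquiv hj).symm_apply_eq.2 this.symm).symm
  have h3 : η.inCoord c (q j).1.1 = (η (π j.base)).compContinuousLinearMap
      ((hq.horEquiv hj).symm : E →L[ℝ] E) := by
    rw [hq.fst_fst hj, Form.inCoord, c.left_inv (hq.proj_source hj)]
    rfl
  rw [coordContraction, h1, h3, contraction_map, ← h2, fibreEquiv_eq]

variable [FiniteDimensional ℝ E]

/-- The value of a contact form is its coefficient functional applied to a contraction of `η`. -/
lemma contactForm_apply (η : Form E X (n + 1)) (j : J1 E F π) (C : (E →L[ℝ] j.Vert) →L[ℝ] ℝ)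
    (v : Fin (n + 1) → J1Model E F) :
    contactForm η j C v =
      C (contraction (η (π j.base)) (j.contact ∘ v) (j.dBaseProj ∘ v)) := by
  rw [contactForm, ContinuousAlternatingMap.alternatizeUncurryFin_apply, contraction, map_sum]
  refine Finset.sum_congr rfl fun i _ => ?_
  have h : ∀ (l : E →L[ℝ] ℝ) (b : j.Vert), l.smulRight b =
      ∑ μ, l (Module.finBasis ℝ E μ) • (LinearMap.toContinuousLinearMap
        ((Module.finBasis ℝ E).coord μ)).smulRight b := by
    intro l b
    ext1 u
    have hu : l u = ∑ μ, l (Module.finBasis ℝ E μ) * (Module.finBasis ℝ E).repr u μ := by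
      conv_lhs => rw [← (Module.finBasis ℝ E).sum_repr u]
      simp [-Module.Basis.sum_repr, mul_comm]
    simp [hu, smul_smul, Finset.sum_smul]
  rw [h, map_smul, map_sum, smul_eq_mul]
  simp only [map_smul, sum_apply, ContinuousLinearMap.smulRight_apply,
    ContinuousAlternatingMap.sum_apply,
    ContinuousAlternatingMap.smul_apply, smul_eq_mul]
  rw [← Int.cast_smul_eq_zsmul ℝ]
  simp only [Int.cast_pow, Int.cast_neg, Int.cast_one, smul_eq_mul]
  congr 1
  refine Finset.sum_congr rfl fun μ _ => ?_
  rw [mul_comm]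
  congr 1

lemma thetaForm_apply (η : Form E X (n + 1)) (j : J1 E F π) (v : Fin (n + 1) → J1Model E F) :
    thetaForm η L j v =
      dFun L j (j.vlift (contraction (η (π j.base)) (j.contact ∘ v) (j.dBaseProj ∘ v))) +
        L j * η (π j.base) (j.dBaseProj ∘ v) := by
  simp only [thetaForm, ContinuousAlternatingMap.add_apply, contactForm_apply]
  rfl

/-- The coordinate expression of `Θ_L`. -/
lemma IsJetChart.thetaForm_inCoord (hq : IsJetChart q e c) (hL : SmoothFunOn L univ)
    (η : Form E X (n + 1)) {z : J1Model E F} (hz : z ∈ q.target)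
    (w : Fin (n + 1) → J1Model E F) :
    (thetaForm η L).inCoord q z w =
      fderiv ℝ (L ∘ q.symm) z ((0 : E × F), coordContraction (η.inCoord c) z w) +
        (L ∘ q.symm) z * η.inCoord c z.1.1 (fun i => (w i).1.1) := by
  obtain ⟨j, hj, rfl⟩ : ∃ j ∈ q.source, q j = z := ⟨q.symm z, q.map_target hz, q.right_inv hz⟩
  rw [Form.inCoord_apply_chart _ hj, thetaForm_apply, hq.dFun_vlift hL hj,
    hq.coordContraction_eq η hj, Function.comp_apply, q.left_inv hj, hq.fst_fst hj,
    Form.inCoord_apply_chart _ (hq.proj_source hj)]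
  congr 3
  funext i
  have := hq.horEquiv_dBaseProj hj (dChartSymm q (q j) (w i))
  rw [hq.dChart_dChartSymm_apply hj] at this
  exact (hq.horEquiv hj).symm_apply_eq.2 this.symm |>.symm

variable [IsManifold 𝓘(ℝ, E) ∞ X]

lemma IsJetChart.contDiffOn_thetaForm [FiniteDimensional ℝ F]
    (hq : IsJetChart q e c) (hL : SmoothFunOn L univ)
    {η : Form E X (n + 1)} (hη : η.SmoothOn univ) :
    ContDiffOn ℝ ∞ ((thetaForm η L).inCoord q) q.target := by
  refine contDiffOn_form fun w => ?_
  refine ContDiffOn.congr ?_ fun z hz => hq.thetaForm_inCoord hL η hz w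
  have hρ : ∀ x : Fin (n + 1) → E,
      ContDiffOn ℝ ∞ (fun z : J1Model E F => η.inCoord c z.1.1 x) q.target := by
    intro x
    have h1 : ContDiffOn ℝ ∞ (fun z : J1Model E F => η.inCoord c z.1.1) q.target :=
      (hη.contDiffOn_inCoord hq.adapted.mem_right).comp
        (contDiff_fst.comp contDiff_fst).contDiffOn
        (fun z hz => hq.adapted.fst_mem (hq.mem_target.1 hz))
    exact (ContinuousLinearMap.contDiff ((ContinuousMultilinearMap.apply ℝ
      (fun _ : Fin (n + 1) => E) ℝ x).comp
        (ContinuousAlternatingMap.toContinuousMultilinearMapCLM ℝ))).comp_contDiffOn h1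
  have hM : ContDiffOn ℝ ∞
      (fun z : J1Model E F => coordContraction (η.inCoord c) z w) q.target := by
    rw [contDiffOn_clm_apply]
    intro u
    simp only [coordContraction, contraction_apply]
    refine ContDiffOn.sum fun i _ => (contDiffOn_const.mul (hρ _)).smul ?_
    exact contDiffOn_const.sub (contDiff_snd.contDiffOn.clm_apply contDiffOn_const)
  exact ((hL.contDiffOn_fderiv_comp_symm hq).clm_apply (contDiffOn_const.prodMk hM)).add
    ((hL.contDiffOn_comp_symm hq).mul (hρ _))

/-- The derivative of `Θ_L` in the direction of `Z = Zᵃ_μ ∂/∂yᵃ_μ` is the contact form with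
coefficients `Zᵃ_μ ∂²L/∂yᵃ_μ∂yᵇ_ν`: the contributions of `-yᵃ_ν dx^ν` and of `L η` cancel. -/
lemma IsJetChart.fderiv_thetaForm [FiniteDimensional ℝ F] (hdim : Module.finrank ℝ E = n + 1)
    (hq : IsJetChart q e c) (hL : SmoothFunOn L univ)
    {η : Form E X (n + 1)} (hη : η.SmoothOn univ) {j : J1 E F π} (hj : j ∈ q.source)
    (Z : E →L[ℝ] j.Vert) (w : Fin (n + 1) → J1Model E F) :
    fderiv ℝ ((thetaForm η L).inCoord q) (q j) ((0 : E × F), hq.fibreEquiv hj Z) w =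
      contactForm η j (hessian L j Z) (dChartSymm q (q j) ∘ w) := by
  have hz := q.map_source hj
  rw [contactForm_apply, hq.hessian_eq hL hj, ← hq.coordContraction_eq η hj]
  set z := q j
  set P := hq.fibreEquiv hj Z
  have hΘ : DifferentiableAt ℝ ((thetaForm η L).inCoord q) z :=
    ((hq.contDiffOn_thetaForm hL hη).contDiffAt
      (q.open_target.mem_nhds hz)).differentiableAt (by simp)
  have hL1 : DifferentiableAt ℝ (L ∘ q.symm) z :=
    ((hL.contDiffOn_comp_symm hq).contDiffAt (q.open_target.mem_nhds hz)).differentiableAt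
      (by simp)
  have hL2 : DifferentiableAt ℝ (fderiv ℝ (L ∘ q.symm)) z :=
    ((hL.contDiffOn_fderiv_comp_symm hq).contDiffAt
      (q.open_target.mem_nhds hz)).differentiableAt (by simp)
  set v : J1Model E F := ((0 : E × F), P)
  have hline : HasDerivAt (fun t : ℝ => z + t • v) v 0 := by
    simpa using ((hasDerivAt_id (0 : ℝ)).smul_const v).const_add z
  have hz0 : z + (0 : ℝ) • v = z := by simp
  have hmem : ∀ t : ℝ, z + t • v ∈ q.target := fun t => by
    rw [hq.mem_target]
    simpa [v] using hq.mem_target.1 hz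
  -- the derivative of `Θ_L` is computed along the line `z + t v`, which stays in the chart
  have hd : HasDerivAt (fun t : ℝ => (thetaForm η L).inCoord q (z + t • v) w)
      (fderiv ℝ ((thetaForm η L).inCoord q) z v w) 0 := by
    rw [fderiv_apply_form hΘ]
    have h1 : HasFDerivAt (fun z => (thetaForm η L).inCoord q z w)
        (fderiv ℝ (fun z => (thetaForm η L).inCoord q z w) z) (z + (0 : ℝ) • v) := by
      rw [hz0]
      exact (hΘ.continuousAlternatingMap_apply_const w).hasFDerivAt
    exact h1.comp_hasDerivAt (0 : ℝ) hline
  set M := coordContraction (η.inCoord c) z w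
  set r := η.inCoord c z.1.1 (fun i => (w i).1.1)
  -- the term with the factor `t` comes from the dependence of `θᵃ` on `y_x`; its derivative cancels
  -- the one of the term `L η`
  have hfun : (fun t : ℝ => (thetaForm η L).inCoord q (z + t • v) w) = fun t =>
      fderiv ℝ (L ∘ q.symm) (z + t • v) ((0 : E × F), M) -
        t * (r * fderiv ℝ (L ∘ q.symm) (z + t • v) v) + (L ∘ q.symm) (z + t • v) * r := by
    funext t
    have h1 : ((0 : E × F), M - t • r • P) = ((0 : E × F), M) - t • r • v := by
      simp [v]
    have h2 : (z + t • v).1.1 = z.1.1 := by simp [v]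
    rw [hq.thetaForm_inCoord hL η (hmem t), coordContraction_add hdim, h1, h2, map_sub, map_smul,
      map_smul, smul_eq_mul, smul_eq_mul]
  have hL1' : HasDerivAt (fun t : ℝ => (L ∘ q.symm) (z + t • v)) (fderiv ℝ (L ∘ q.symm) z v) 0 :=
    (show HasFDerivAt (L ∘ q.symm) (fderiv ℝ (L ∘ q.symm) z) (z + (0 : ℝ) • v) by
      rw [hz0]; exact hL1.hasFDerivAt).comp_hasDerivAt (0 : ℝ) hline
  have hL2' : HasDerivAt (fun t : ℝ => fderiv ℝ (L ∘ q.symm) (z + t • v))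
      (fderiv ℝ (fderiv ℝ (L ∘ q.symm)) z v) 0 :=
    (show HasFDerivAt (fderiv ℝ (L ∘ q.symm)) (fderiv ℝ (fderiv ℝ (L ∘ q.symm)) z)
      (z + (0 : ℝ) • v) by rw [hz0]; exact hL2.hasFDerivAt).comp_hasDerivAt (0 : ℝ) hline
  have happ : ∀ u : J1Model E F, HasDerivAt (fun t : ℝ => fderiv ℝ (L ∘ q.symm) (z + t • v) u)
      (fderiv ℝ (fderiv ℝ (L ∘ q.symm)) z v u) 0 := fun u => by
    simpa using hL2'.clm_apply (hasDerivAt_const (0 : ℝ) u)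
  rw [hfun] at hd
  have hd' := ((happ ((0 : E × F), M)).sub ((hasDerivAt_id (0 : ℝ)).mul
    ((happ v).const_mul r))).add (hL1'.mul_const r)
  have := hd.unique hd'
  rw [this]
  simp only [hz0, id_eq, zero_mul, one_mul, add_zero]
  ring

/-- The contraction of `Ω_L` with a vertical vector `Zᵃ_μ ∂/∂yᵃ_μ`. Since `Θ_L` is annihilated by
such vectors, `i_Z dΘ_L` is the derivative of `Θ_L` along a vertical field with constant
coefficients. -/
lemma omegaForm_vlift [FiniteDimensional ℝ F] (hdim : Module.finrank ℝ E = n + 1)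
    (hL : SmoothFunOn L univ) {η : Form E X (n + 1)} (hη : η.SmoothOn univ) (j : J1 E F π)
    (Z : E →L[ℝ] j.Vert) :
    (omegaForm η L j).curryLeft (j.vlift Z) = -contactForm η j (hessian L j Z) := by
  obtain ⟨e, c, hq⟩ := exists_isJetChart j
  have hj := mem_chart_source (J1Model E F) j
  have hz := (chartAt (J1Model E F) j).map_source hj
  have hΘ : DifferentiableAt ℝ ((thetaForm η L).inCoord (chartAt (J1Model E F) j))
      (chartAt (J1Model E F) j j) :=
    ((hq.contDiffOn_thetaForm hL hη).contDiffAt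
      ((chartAt (J1Model E F) j).open_target.mem_nhds hz)).differentiableAt (by simp)
  ext w
  have h1 := hq.fderiv_thetaForm hdim hL hη hj Z (dChart (chartAt (J1Model E F) j) j ∘ w)
  have h2 : dChartSymm (chartAt (J1Model E F) j) (chartAt (J1Model E F) j j) ∘
      dChart (chartAt (J1Model E F) j) j ∘ w = w :=
    funext fun i => DFunLike.congr_fun (dChartSymm_comp_dChart hq.mem hj) (w i)
  rw [h2] at h1
  rw [ContinuousAlternatingMap.neg_apply, ← h1,
    ← extDeriv_cons_of_apply_cons_eq_zero hΘ]
  · rw [ContinuousAlternatingMap.curryLeft_apply_apply, omegaForm,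
      ContinuousAlternatingMap.neg_apply, Form.d]
    refine congrArg Neg.neg ?_
    rw [ContinuousAlternatingMap.compContinuousLinearMap_apply]
    change extDeriv _ _ _ = extDeriv _ _ _
    congr 1
    funext l
    refine Fin.cases ?_ (fun l => ?_) l
    · exact hq.dChart_vlift hj Z
    · rfl
  · filter_upwards [(chartAt (J1Model E F) j).open_target.mem_nhds hz] with z' hz' u
    rw [hq.thetaForm_inCoord hL η hz', coordContraction, contraction_cons_zero _ _ _ (by simp)
      (by simp), ContinuousAlternatingMap.map_coord_zero _ 0 (by simp), mul_zero, add_zero]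
    exact map_zero _

end Jets

/-! ### Smooth vector fields in coordinates -/

section Manifolds

variable {W : Type*} [NormedAddCommGroup W] [NormedSpace ℝ W]
  {M : Type*} [TopologicalSpace M] [ChartedSpace W M] [IsManifold 𝓘(ℝ, W) ∞ M]

lemma trivializationAt_snd_eq {j₀ j : M} (hj : j ∈ (chartAt W j₀).source)
    (v : TangentSpace 𝓘(ℝ, W) j) :
    (trivializationAt W (TangentSpace 𝓘(ℝ, W)) j₀ ⟨j, v⟩).2 = dChart (chartAt W j₀) j v := by
  have : IsManifold 𝓘(ℝ, W) 1 M := .of_le (n := ∞) (by simp)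
  have h1 := TangentBundle.continuousLinearMapAt_trivializationAt
    (I := 𝓘(ℝ, W)) (x₀ := j₀) (x := j) hj
  have h2 : (trivializationAt W (TangentSpace 𝓘(ℝ, W)) j₀).continuousLinearMapAt ℝ j v =
      dChart (chartAt W j₀) j v := DFunLike.congr_fun h1 v
  rw [← h2, Bundle.Trivialization.continuousLinearMapAt_apply,
    Bundle.Trivialization.coe_linearMapAt_of_mem]
  simpa using hj

lemma contMDiffAt_field {ζ : M → W} {j₀ : M}
    (h : ContMDiffAt 𝓘(ℝ, W) 𝓘(ℝ, W) ∞ (fun j => dChart (chartAt W j₀) j (ζ j)) j₀) :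
    ContMDiffAt 𝓘(ℝ, W) 𝓘(ℝ, W).tangent ∞
      (fun j => (⟨j, ζ j⟩ : TangentBundle 𝓘(ℝ, W) M)) j₀ := by
  refine (Bundle.contMDiffAt_section (F := W) (E := TangentSpace 𝓘(ℝ, W)) (s := ζ) j₀).2 ?_
  refine h.congr_of_eventuallyEq ?_
  filter_upwards [(chartAt W j₀).open_source.mem_nhds (mem_chart_source W j₀)] with j hj
  exact trivializationAt_snd_eq hj _

end Manifolds

section Jets

variable {E F : Type*} [NormedAddCommGroup E] [NormedSpace ℝ E]
  [NormedAddCommGroup F] [NormedSpace ℝ F] {X Y : Type*} [TopologicalSpace X]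
  [ChartedSpace E X] [TopologicalSpace Y] [ChartedSpace (E × F) Y] {π : Y → X}
  {L : J1 E F π → ℝ} {n : ℕ} {η : Form E X (n + 1)}

/-! ### Inverting the Hessian and the contact forms -/

lemma IsRegularLagrangian.hessian_injective (hreg : IsRegularLagrangian L) (j : J1 E F π) :
    Function.Injective (hessian L j) := by
  refine (injective_iff_map_eq_zero _).2 fun B hB => hreg j B fun B' => ?_
  rw [hB]
  rfl

variable [FiniteDimensional ℝ E]

lemma IsRegularLagrangian.hessian_surjective [FiniteDimensional ℝ F]
    (hreg : IsRegularLagrangian L) (j : J1 E F π) : Function.Surjective (hessian L j) := by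
  have h : Module.finrank ℝ (E →L[ℝ] j.Vert) = Module.finrank ℝ ((E →L[ℝ] j.Vert) →L[ℝ] ℝ) := by
    rw [← (LinearMap.toContinuousLinearMap (𝕜 := ℝ) (E := E →L[ℝ] j.Vert)
      (F' := ℝ)).finrank_eq]
    exact Subspace.dual_finrank_eq.symm
  exact (LinearMap.injective_iff_surjective_of_finrank_eq_finrank
    (f := (hessian L j).toLinearMap) h).1 (hreg.hessian_injective j)

lemma eq_zero_of_forall_apply_eq_zero {V : Type*} [NormedAddCommGroup V] [NormedSpace ℝ V]
    [FiniteDimensional ℝ V] {B : V} (h : ∀ C : V →L[ℝ] ℝ, C B = 0) : B = 0 :=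
  (Module.forall_dual_apply_eq_zero_iff ℝ B).1 fun C => h (LinearMap.toContinuousLinearMap C)

variable [IsManifold 𝓘(ℝ, E × F) ∞ Y] [IsFibredManifold E F π]

/-- The coefficients of a contact form are determined by its values: by `contraction_comp`, every
`B` is, up to a factor, a contraction of `η`. -/
lemma contactForm_injective (hdim : Module.finrank ℝ E = n + 1) {j : J1 E F π}
    (hη : η (π j.base) ≠ 0) : Function.Injective (contactForm η j) := by
  obtain ⟨x, hx⟩ : ∃ x, η (π j.base) x ≠ 0 := by
    by_contra! h'
    exact hη (ContinuousAlternatingMap.ext h')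
  intro C C' h
  ext B
  choose v hv hv' using fun i => j.exists_contact_eq (B (x i)) (x i)
  have h1 := DFunLike.congr_fun h v
  rw [contactForm_apply, contactForm_apply, show j.contact ∘ v = B ∘ x from funext hv,
    show j.dBaseProj ∘ v = x from funext hv', contraction_comp hdim, map_smul, map_smul] at h1
  exact smul_right_injective _ hx h1

lemma contactForm_zero (j : J1 E F π) : contactForm η j 0 = 0 := by
  ext v
  simp [contactForm_apply]

/-! ### The bundle of constraint forms -/

variable {ℱ : Submodule ℝ (Form (J1Model E F) (J1 E F π) (n + 1))} {k : ℕ}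
  {U : Set (J1 E F π)} {Φ : Fin k → Form (J1Model E F) (J1 E F π) (n + 1)}

/-- The vectors at `j` which are vertical over `Y` and whose contraction with `Ω_L` is the value
of an element of `ℱ`. -/
def constraintDistribution (η : Form E X (n + 1)) (L : J1 E F π → ℝ)
    (ℱ : Submodule ℝ (Form (J1Model E F) (J1 E F π) (n + 1))) (j : J1 E F π) :
    Submodule ℝ (J1Model E F) :=
  LinearMap.ker j.dBase.toLinearMap ⊓
    (ℱ.map (LinearMap.proj (φ := fun _ : J1 E F π => J1Model E F [⋀^Fin (n + 1)]→L[ℝ] ℝ) j)).comap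
      (omegaForm η L j).curryLeft.toLinearMap

lemma mem_constraintDistribution {j : J1 E F π} {v : J1Model E F} :
    v ∈ constraintDistribution η L ℱ j ↔
      j.dBase v = 0 ∧ (omegaForm η L j).curryLeft v ∈ constraintBundle ℱ j :=
  Iff.rfl

/-- The fibre at `j` of the bundle of constraint forms is spanned by the values of local
generators. -/
lemma IsLocalGenerators.map_proj (h : IsLocalGenerators η ℱ U Φ) {j : J1 E F π} (hj : j ∈ U) :
    ℱ.map (LinearMap.proj (φ := fun _ : J1 E F π => J1Model E F [⋀^Fin (n + 1)]→L[ℝ] ℝ) j) =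
      Submodule.span ℝ (range fun α => Φ α j) := by
  apply le_antisymm
  · rintro _ ⟨Ψ, hΨ, rfl⟩
    obtain ⟨f, -, hf⟩ := h.generate Ψ hΨ
    rw [LinearMap.proj_apply, hf j hj]
    exact Submodule.sum_mem _ fun α _ => Submodule.smul_mem _ _ (Submodule.subset_span ⟨α, rfl⟩)
  · rw [Submodule.span_le]
    rintro _ ⟨α, rfl⟩
    obtain ⟨r, Ψ, f, hΨ, -, hf⟩ := h.mem α
    change Φ α j ∈ _
    rw [hf j hj]
    exact Submodule.sum_mem _ fun i _ => Submodule.smul_mem _ _ ⟨Ψ i, hΨ i, rfl⟩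

/-- If there is at least one constraint form, then the fibres of `π` have positive dimension. This
is needed for the absence of characteristic vectors, as `Ω_L = 0` if the fibres are discrete. -/
lemma IsLocalGenerators.nontrivial_vert (h : IsLocalGenerators η ℱ U Φ) {j : J1 E F π}
    (hj : j ∈ U) (α : Fin k) : Nontrivial j.Vert := by
  by_contra! hV
  obtain ⟨C, hC⟩ := h.form α j hj
  refine (h.independent j hj).ne_zero α ?_
  have : C = 0 := by
    ext B
    rw [Subsingleton.elim B 0, map_zero, map_zero]
  simp only [hC, this, contactForm_zero]

/-- The coefficients of the constraint fields, obtained by inverting the Hessian. Outside `U` their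
values are arbitrary. -/
lemma IsLocalGenerators.exists_coefficients [FiniteDimensional ℝ F]
    (hreg : IsRegularLagrangian L) (h : IsLocalGenerators η ℱ U Φ) :
    ∃ Z : Fin k → ∀ j : J1 E F π, E →L[ℝ] j.Vert,
      ∀ α, ∀ j ∈ U, Φ α j = contactForm η j (hessian L j (Z α j)) := by
  have h1 : ∀ α (j : J1 E F π), ∃ Z : E →L[ℝ] j.Vert,
      j ∈ U → Φ α j = contactForm η j (hessian L j Z) := by
    intro α j
    by_cases hj : j ∈ U
    · obtain ⟨C, hC⟩ := h.form α j hj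
      obtain ⟨Z, rfl⟩ := hreg.hessian_surjective j C
      exact ⟨Z, fun _ => hC⟩
    · exact ⟨0, fun h => absurd h hj⟩
  choose Z hZ using h1
  exact ⟨Z, hZ⟩

lemma IsLocalGenerators.linearIndependent (h : IsLocalGenerators η ℱ U Φ)
    {ζ : Fin k → J1 E F π → J1Model E F}
    (hζ : ∀ α, IsConstraintField η L U (Φ α) (ζ α)) {j : J1 E F π} (hj : j ∈ U) :
    LinearIndependent ℝ fun α => ζ α j := by
  refine LinearIndependent.of_comp (-(omegaForm η L j).curryLeft.toLinearMap) ?_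
  convert h.independent j hj using 1
  funext α
  have := (hζ α).contract_eq j hj
  simp [this]

/-! ### Characteristic vectors of the Poincaré–Cartan form -/

variable [FiniteDimensional ℝ F] [IsManifold 𝓘(ℝ, E) ∞ X]

/-- `Ω_L` has no characteristic vectors, provided that the fibres of `π` have positive dimension
and the base has dimension at least `2`. Contraction with vertical vectors shows first that a
characteristic vector `v` is itself vertical, and then that it vanishes. -/
lemma eq_zero_of_omegaForm_curryLeft_eq_zero (hn : 1 ≤ n) (hdim : Module.finrank ℝ E = n + 1)
    (hη : IsVolumeForm η) (hL : SmoothFunOn L univ) (hreg : IsRegularLagrangian L)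
    {j : J1 E F π} [Nontrivial j.Vert] {v : J1Model E F}
    (hv : (omegaForm η L j).curryLeft v = 0) : v = 0 := by
  have key : ∀ (θ : Fin n → j.Vert) (x : Fin n → E), contraction (η (π j.base))
      (Fin.cons (j.contact v) θ : Fin (n + 1) → j.Vert)
      (Fin.cons (j.dBaseProj v) x : Fin (n + 1) → E) = 0 := by
    intro θ x
    choose w hw hw' using fun i => j.exists_contact_eq (θ i) (x i)
    refine eq_zero_of_forall_apply_eq_zero fun C => ?_
    obtain ⟨Z, rfl⟩ := hreg.hessian_surjective j C
    -- `Ω_L (v, Z, w) = -Ω_L (Z, v, w)` is a value of a contact form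
    have h1 : omegaForm η L j (Fin.cons v (Fin.cons (j.vlift Z) w : Fin (n + 1) → _)) = 0 :=
      DFunLike.congr_fun hv _
    have h2 := DFunLike.congr_fun (omegaForm_vlift hdim hL hη.smooth j Z)
      (Fin.cons v w : Fin (n + 1) → J1Model E F)
    rw [ContinuousAlternatingMap.neg_apply, contactForm_apply, Fin.comp_cons, Fin.comp_cons,
      show j.contact ∘ w = θ from funext hw, show j.dBaseProj ∘ w = x from funext hw'] at h2
    rw [map_cons_cons, neg_eq_zero] at h1
    exact neg_eq_zero.1 (h2.symm.trans h1)
  obtain ⟨h1, h2⟩ := eq_zero_of_contraction_cons hn hdim (hη.ne_zero _) key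
  obtain ⟨Z, rfl⟩ := J1.exists_vlift_eq h2 h1
  rw [omegaForm_vlift hdim hL hη.smooth, neg_eq_zero, ← contactForm_zero (η := η) j] at hv
  rw [hreg.hessian_injective j ((contactForm_injective hdim (hη.ne_zero _) hv).trans
    (map_zero _).symm), map_zero]

lemma omegaForm_curryLeft_vlift_injective (hdim : Module.finrank ℝ E = n + 1)
    (hη : IsVolumeForm η) (hL : SmoothFunOn L univ) (hreg : IsRegularLagrangian L)
    (j : J1 E F π) : Function.Injective fun Z => (omegaForm η L j).curryLeft (j.vlift Z) := by
  intro Z Z' h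
  simp only [omegaForm_vlift hdim hL hη.smooth, neg_inj] at h
  exact hreg.hessian_injective j (contactForm_injective hdim (hη.ne_zero _) h)

/-! ### Smoothness of the constraint fields -/

/-- A vertical field `Z` whose contraction with `Ω_L` is a smooth form is smooth: its coordinates
solve a linear system with smooth coefficients, which is injective by the regularity of `L`. -/
lemma smoothFieldOn_vlift (hdim : Module.finrank ℝ E = n + 1)
    (hη : IsVolumeForm η) (hL : SmoothFunOn L univ) (hreg : IsRegularLagrangian L)
    {U : Set (J1 E F π)} (hU : IsOpen U) {Φ : Form (J1Model E F) (J1 E F π) (n + 1)}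
    (hΦ : Φ.SmoothOn U) {Z : ∀ j : J1 E F π, E →L[ℝ] j.Vert}
    (hZ : ∀ j ∈ U, Φ j = contactForm η j (hessian L j (Z j))) :
    SmoothFieldOn (fun j => j.vlift (Z j)) U := by
  intro j₀ hj₀
  refine ContMDiffAt.contMDiffWithinAt ?_
  obtain ⟨e, c, hq⟩ := exists_isJetChart j₀
  have hj := mem_chart_source (J1Model E F) j₀
  have hΘ := hq.contDiffOn_thetaForm hL hη.smooth
  have hsm := hΦ j₀
  set q := chartAt (J1Model E F) j₀
  have hz := q.map_source hj
  have hopen : IsOpen (q.target ∩ q.symm ⁻¹' U) := q.isOpen_inter_preimage_symm hU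
  have hz' : q j₀ ∈ q.target ∩ q.symm ⁻¹' U := ⟨hz, by simpa [q.left_inv hj] using hj₀⟩
  -- the linear system satisfied by the coordinates of the field
  set A : J1Model E F → (E →L[ℝ] F) →L[ℝ] _ := fun z => (basisEval (J1Model E F) (n + 1)).comp
    ((fderiv ℝ ((thetaForm η L).inCoord q) z).comp (ContinuousLinearMap.inr ℝ (E × F) (E →L[ℝ] F)))
  set p : J1Model E F → E →L[ℝ] F := fun z =>
    (dChart q (q.symm z) ((q.symm z).vlift (Z (q.symm z)))).2
  have hA : ContDiffAt ℝ ∞ A (q j₀) :=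
    contDiffAt_const.clm_comp (((hΘ.fderiv_of_isOpen q.open_target (by simp)).contDiffAt
      (q.open_target.mem_nhds hz)).clm_comp contDiffAt_const)
  have hb : ContDiffAt ℝ ∞ (fun z => basisEval (J1Model E F) (n + 1) (Φ.inCoord q z)) (q j₀) :=
    (ContinuousLinearMap.contDiff _).contDiffAt.comp (q j₀)
      (hsm.contDiffAt (hopen.mem_nhds hz'))
  have hinj : Function.Injective (A (q j₀)) := by
    refine (injective_iff_map_eq_zero _).2 fun P hP => ?_
    obtain ⟨B, rfl⟩ := (hq.fibreEquiv hj).surjective P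
    have h1 : fderiv ℝ ((thetaForm η L).inCoord q) (q j₀) ((0 : E × F), hq.fibreEquiv hj B) = 0 :=
      basisEval_injective (hP.trans (map_zero _).symm)
    have h2 : contactForm η j₀ (hessian L j₀ B) = contactForm η j₀ 0 := by
      ext w
      have h3 := hq.fderiv_thetaForm hdim hL hη.smooth hj B (dChart q j₀ ∘ w)
      have h4 : dChartSymm q (q j₀) ∘ dChart q j₀ ∘ w = w :=
        funext fun i => DFunLike.congr_fun (dChartSymm_comp_dChart hq.mem hj) (w i)
      rw [h4, h1] at h3
      rw [← h3, contactForm_zero]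
      rfl
    rw [hreg.hessian_injective j₀ ((contactForm_injective hdim (hη.ne_zero _) h2).trans
      (map_zero _).symm), map_zero]
  have hp : ∀ᶠ z in 𝓝 (q j₀), A z (p z) = basisEval (J1Model E F) (n + 1) (Φ.inCoord q z) := by
    filter_upwards [hopen.mem_nhds hz'] with z hzU
    obtain ⟨j, hjs, rfl⟩ : ∃ j ∈ q.source, q j = z :=
      ⟨q.symm z, q.map_target hzU.1, q.right_inv hzU.1⟩
    have hjU : j ∈ U := by simpa [q.left_inv hjs] using hzU.2
    refine congrArg (basisEval (J1Model E F) (n + 1)) ?_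
    ext w
    have h1 : p (q j) = hq.fibreEquiv hjs (Z j) := by
      simp only [p]
      rw [q.left_inv hjs, hq.dChart_vlift hjs]
    change fderiv ℝ ((thetaForm η L).inCoord q) (q j) ((0 : E × F), p (q j)) w = _
    rw [h1, hq.fderiv_thetaForm hdim hL hη.smooth hjs, Form.inCoord_apply_chart _ hjs, hZ j hjU]
  have hpsm := contDiffAt_of_apply_eq hA hb hinj hp
  apply contMDiffAt_field
  have hcomp : ContMDiffAt 𝓘(ℝ, J1Model E F) 𝓘(ℝ, J1Model E F) ∞
      ((fun z => ((0 : E × F), p z)) ∘ q) j₀ :=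
    ContMDiffAt.comp j₀ (contDiffAt_const.prodMk hpsm).contMDiffAt
      (contMDiffAt_of_mem_maximalAtlas hq.mem hj)
  refine hcomp.congr_of_eventuallyEq ?_
  filter_upwards [q.open_source.mem_nhds hj] with j hjs
  change dChart q j _ = ((0 : E × F), p (q j))
  simp only [p]
  rw [q.left_inv hjs, hq.dChart_vlift hjs]

/-! ### The constraint fields and their span -/

lemma IsLocalGenerators.eq_of_isConstraintField (hn : 1 ≤ n)
    (hdim : Module.finrank ℝ E = n + 1) (hη : IsVolumeForm η) (hL : SmoothFunOn L univ)
    (hreg : IsRegularLagrangian L) (h : IsLocalGenerators η ℱ U Φ) {α : Fin k}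
    {ζ ζ' : J1 E F π → J1Model E F} (hζ : IsConstraintField η L U (Φ α) ζ)
    (hζ' : IsConstraintField η L U (Φ α) ζ') {j : J1 E F π} (hj : j ∈ U) : ζ j = ζ' j := by
  have := h.nontrivial_vert hj α
  rw [← sub_eq_zero]
  refine eq_zero_of_omegaForm_curryLeft_eq_zero (j := j) hn hdim hη hL hreg ?_
  rw [map_sub, hζ.contract_eq j hj, hζ'.contract_eq j hj, sub_self]

lemma isConstraintField_vlift (hdim : Module.finrank ℝ E = n + 1) (hη : IsVolumeForm η)
    (hL : SmoothFunOn L univ) (hreg : IsRegularLagrangian L)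
    (h : IsLocalGenerators η ℱ U Φ) {Z : Fin k → ∀ j : J1 E F π, E →L[ℝ] j.Vert}
    (hZ : ∀ α, ∀ j ∈ U, Φ α j = contactForm η j (hessian L j (Z α j))) (α : Fin k) :
    IsConstraintField η L U (Φ α) (fun j => j.vlift (Z α j)) where
  smooth := smoothFieldOn_vlift hdim hη hL hreg h.isOpen (h.smooth α) (hZ α)
  contract_eq j hj := by rw [omegaForm_vlift hdim hL hη.smooth, hZ α j hj]

lemma IsLocalGenerators.dBase_eq_zero (hn : 1 ≤ n)
    (hdim : Module.finrank ℝ E = n + 1) (hη : IsVolumeForm η) (hL : SmoothFunOn L univ)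
    (hreg : IsRegularLagrangian L) (h : IsLocalGenerators η ℱ U Φ) {α : Fin k}
    {ζ : J1 E F π → J1Model E F} (hζ : IsConstraintField η L U (Φ α) ζ)
    {j : J1 E F π} (hj : j ∈ U) : j.dBase (ζ j) = 0 := by
  obtain ⟨Z, hZ⟩ := h.exists_coefficients hreg
  rw [h.eq_of_isConstraintField hn hdim hη hL hreg hζ
    (isConstraintField_vlift hdim hη hL hreg h hZ α) hj, J1.dBase_vlift]

/-- The span of the constraint fields depends only on the bundle of constraint forms: it consists of
the vertical vectors whose contraction with `Ω_L` is a constraint form. -/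
lemma IsLocalGenerators.spanAt_eq (hn : 1 ≤ n)
    (hdim : Module.finrank ℝ E = n + 1) (hη : IsVolumeForm η) (hL : SmoothFunOn L univ)
    (hreg : IsRegularLagrangian L) (h : IsLocalGenerators η ℱ U Φ)
    {ζ : Fin k → J1 E F π → J1Model E F}
    (hζ : ∀ α, IsConstraintField η L U (Φ α) (ζ α)) {j : J1 E F π} (hj : j ∈ U) :
    spanAt ζ j = constraintDistribution η L ℱ j := by
  rw [constraintDistribution, h.map_proj hj]
  have hvert : ∀ α, j.dBase (ζ α j) = 0 := fun α =>
    h.dBase_eq_zero hn hdim hη hL hreg (hζ α) hj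
  have hle : spanAt ζ j ≤ LinearMap.ker j.dBase.toLinearMap := by
    rw [spanAt, Submodule.span_le]
    rintro _ ⟨α, rfl⟩
    exact hvert α
  apply le_antisymm
  · refine le_inf hle ?_
    rw [spanAt, Submodule.span_le]
    rintro _ ⟨α, rfl⟩
    change (omegaForm η L j).curryLeft (ζ α j) ∈ Submodule.span ℝ (range fun α => Φ α j)
    rw [(hζ α).contract_eq j hj]
    exact Submodule.neg_mem _ (Submodule.subset_span ⟨α, rfl⟩)
  · rintro v ⟨hv, hv'⟩
    obtain ⟨a, ha⟩ := (Submodule.mem_span_range_iff_exists_fun ℝ).1 hv'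
    have hmem : (-∑ α, a α • ζ α j) ∈ spanAt ζ j :=
      Submodule.neg_mem _ (Submodule.sum_mem _ fun α _ =>
        Submodule.smul_mem _ _ (Submodule.subset_span ⟨α, rfl⟩))
    obtain ⟨B, hB⟩ := J1.exists_vlift_eq_of_dBase (show j.dBase v = 0 from hv)
    obtain ⟨B', hB'⟩ := J1.exists_vlift_eq_of_dBase (show j.dBase _ = 0 from hle hmem)
    -- `v` and `-∑ a_α ζ_α` are vertical and have the same contraction with `Ω_L`
    have h1 : (omegaForm η L j).curryLeft v =
        (omegaForm η L j).curryLeft (-∑ α, a α • ζ α j) := by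
      rw [map_neg, map_sum, ← Finset.sum_neg_distrib]
      refine ha.symm.trans (Finset.sum_congr rfl fun α _ => ?_)
      rw [map_smul, (hζ α).contract_eq j hj, smul_neg, neg_neg]
    rw [← hB, ← hB'] at h1
    rw [← hB, omegaForm_curryLeft_vlift_injective hdim hη hL hreg j h1, hB']
    exact hmem

end Jets

end FieldTheory

end

theorem mainTheorem2
    {E F X Y : Type*}
    [NormedAddCommGroup E] [NormedSpace ℝ E] [FiniteDimensional ℝ E]
    [NormedAddCommGroup F] [NormedSpace ℝ F] [FiniteDimensional ℝ F]
    [TopologicalSpace X] [ChartedSpace E X] [IsManifold 𝓘(ℝ, E) ∞ X]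
    [TopologicalSpace Y] [ChartedSpace (E × F) Y] [IsManifold 𝓘(ℝ, E × F) ∞ Y]
    (π : Y → X) [IsFibredManifold E F π]
    (n : ℕ) (hn : 1 ≤ n) (hdim : Module.finrank ℝ E = n + 1)
    (η : Form E X (n + 1)) (hη : IsVolumeForm η)
    (L : J1 E F π → ℝ) (hL : SmoothFunOn L Set.univ) (hreg : IsRegularLagrangian L)
    (k : ℕ) (C : Set (J1 E F π)) (hC : IsConstraintSubmanifold C k)
    (N : Set (J1 E F π)) (ℱ : Submodule ℝ (Form (J1Model E F) (J1 E F π) (n + 1)))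
    (hℱ : IsConstraintModule η C N k ℱ) :
    -- each local generator determines a unique vector field, which is vertical over `Y` and is
    -- given by the inverse of the Hessian; these fields span a distribution of rank `k`
    (∀ (U : Set (J1 E F π)) (Φ : Fin k → Form (J1Model E F) (J1 E F π) (n + 1)),
      IsLocalGenerators η ℱ U Φ →
      ∃ ζ : Fin k → J1 E F π → J1Model E F,
        (∀ α, IsConstraintField η L U (Φ α) (ζ α)) ∧
        (∀ α ζ', IsConstraintField η L U (Φ α) ζ' → ∀ j ∈ U, ζ' j = ζ α j) ∧
        (∀ α, ∀ j ∈ U, j.dBase (ζ α j) = 0) ∧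
        (∀ α, ∀ j ∈ U, ∀ c, Φ α j = contactForm η j c →
          ∃! Z : E →L[ℝ] j.Vert, ζ α j = j.vlift Z ∧ ∀ B, hessian L j Z B = c B) ∧
        (∀ j ∈ U, Module.finrank ℝ (spanAt ζ j) = k)) ∧
    -- the local distributions agree on overlaps
    (∀ (U U' : Set (J1 E F π)) (Φ Φ' : Fin k → Form (J1Model E F) (J1 E F π) (n + 1))
      (ζ ζ' : Fin k → J1 E F π → J1Model E F),
      IsLocalGenerators η ℱ U Φ → IsLocalGenerators η ℱ U' Φ' →
      (∀ α, IsConstraintField η L U (Φ α) (ζ α)) →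
      (∀ α, IsConstraintField η L U' (Φ' α) (ζ' α)) →
      ∀ j ∈ U ∩ U', spanAt ζ j = spanAt ζ' j) ∧
    -- the resulting distribution `D` along `C`
    (∃ D : C → Submodule ℝ (J1Model E F),
      (∀ (U : Set (J1 E F π)) (Φ : Fin k → Form (J1Model E F) (J1 E F π) (n + 1))
        (ζ : Fin k → J1 E F π → J1Model E F), IsLocalGenerators η ℱ U Φ →
        (∀ α, IsConstraintField η L U (Φ α) (ζ α)) →
        ∀ γ : C, γ.1 ∈ U → D γ = spanAt ζ γ.1) ∧
      (∀ D' : C → Submodule ℝ (J1Model E F),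
        (∀ γ : C, ∃ (U : Set (J1 E F π)) (Φ : Fin k → Form (J1Model E F) (J1 E F π) (n + 1))
          (ζ : Fin k → J1 E F π → J1Model E F), γ.1 ∈ U ∧ IsLocalGenerators η ℱ U Φ ∧
          (∀ α, IsConstraintField η L U (Φ α) (ζ α)) ∧ D' γ = spanAt ζ γ.1) → D' = D) ∧
      (∀ γ : C, Module.finrank ℝ (D γ) = k) ∧
      (∀ (γ : C) (v : J1Model E F), v ∈ D γ ↔
        γ.1.dBase v = 0 ∧ (omegaForm η L γ.1).curryLeft v ∈ constraintBundle ℱ γ.1)) := by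
  have hfields : ∀ (U : Set (J1 E F π)) (Φ : Fin k → Form (J1Model E F) (J1 E F π) (n + 1)),
      IsLocalGenerators η ℱ U Φ → ∃ ζ : Fin k → J1 E F π → J1Model E F,
        ∀ α, IsConstraintField η L U (Φ α) (ζ α) := fun U Φ hΦ => by
    obtain ⟨Z, hZ⟩ := hΦ.exists_coefficients hreg
    exact ⟨_, isConstraintField_vlift hdim hη hL hreg hΦ hZ⟩
  have hrank : ∀ (U : Set (J1 E F π)) (Φ : Fin k → Form (J1Model E F) (J1 E F π) (n + 1))
      (ζ : Fin k → J1 E F π → J1Model E F), IsLocalGenerators η ℱ U Φ →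
      (∀ α, IsConstraintField η L U (Φ α) (ζ α)) →
      ∀ j ∈ U, Module.finrank ℝ (spanAt ζ j) = k := fun U Φ ζ hΦ hζ j hj =>
    (finrank_span_eq_card (hΦ.linearIndependent hζ hj)).trans (Fintype.card_fin k)
  refine ⟨fun U Φ hΦ => ?_, ?_, fun γ => constraintDistribution η L ℱ γ.1, ?_, ?_, ?_, ?_⟩
  · obtain ⟨Z, hZ⟩ := hΦ.exists_coefficients hreg
    have hζ := isConstraintField_vlift hdim hη hL hreg hΦ hZ
    refine ⟨fun α j => j.vlift (Z α j), hζ, ?_, fun α j _ => j.dBase_vlift _, ?_, ?_⟩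
    · exact fun α ζ' hζ' j hj => hΦ.eq_of_isConstraintField hn hdim hη hL hreg hζ' (hζ α) hj
    · intro α j hj c hc
      have h1 : hessian L j (Z α j) = c :=
        contactForm_injective hdim (hη.ne_zero _) ((hZ α j hj).symm.trans hc)
      exact ⟨Z α j, ⟨rfl, fun B => by rw [h1]⟩, fun Z' hZ' => (j.vlift_injective hZ'.1).symm⟩
    · exact hrank U Φ _ hΦ hζ
  · intro U U' Φ Φ' ζ ζ' hΦ hΦ' hζ hζ' j hj
    rw [hΦ.spanAt_eq hn hdim hη hL hreg hζ hj.1, hΦ'.spanAt_eq hn hdim hη hL hreg hζ' hj.2]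
  · exact fun U Φ ζ hΦ hζ γ hγ => (hΦ.spanAt_eq hn hdim hη hL hreg hζ hγ).symm
  · intro D' hD'
    funext γ
    obtain ⟨U, Φ, ζ, hγ, hΦ, hζ, h⟩ := hD' γ
    rw [h, hΦ.spanAt_eq hn hdim hη hL hreg hζ hγ]
  · intro γ
    obtain ⟨U, -, hγ, Φ, hΦ⟩ := hℱ.exists_generators γ.1 γ.2
    obtain ⟨ζ, hζ⟩ := hfields U Φ hΦ
    change Module.finrank ℝ (constraintDistribution η L ℱ γ.1) = k
    rw [← hΦ.spanAt_eq hn hdim hη hL hreg hζ hγ]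
    exact hrank U Φ ζ hΦ hζ γ.1 hγ
  · exact fun γ v => mem_constraintDistribution
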